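/- Let $u\in C^2(\mathbb R)$ with $u,u',u''$ bounded on $\mathbb R$, let $\nu\ge 0$ and $k\in\{-1,0,1\}$. For a time step $\Delta t>0$ let $z_k:\mathbb R\to\mathbb R$ be a solution of $$z_k(x)=x-\frac{\Delta t}{2}\bigl[u(x)+u(z_k(x))\bigr]+k\sqrt{6\,\Delta t\,\nu}\qquad\text{for all }x\in\mathbb R ,$$ and for a space step $\Delta x>0$ let $x_i=i\Delta x$, $i\in\mathbb Z$. Let $p=2r+1$, $r\ge 0$, be an odd degree, and let $(\psi_j)_{j\in\mathbb Z}$ be one of the following cardinal bases of degree $p$ on this grid: (a) symmetric Lagrange interpolation: for $x\in[x_m,x_{m+1})$, $\psi_j(x)$ is the value at $x$ of the Lagrange basis polynomial of the node $x_j$ for the $2r+2$ nodes $x_{m-r},\dots,x_{m+r+1}$ if $m-r\le j\le m+r+1$, and $\psi_j(x)=0$ otherwise; (b) spline interpolation: $\psi_j$ is the bounded function in $C^{2r}(\mathbb R)$ that is a polynomial of degree at most $2r+1$ on each cell $[x_m,x_{m+1}]$ and satisfies $\psi_j(x_i)=\delta_{ij}$ for all $i\in\mathbb Z$. Let $B_k=(b_{k,ij})_{i,j\in\mathbb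 Z}$ with $b_{k,ij}=\psi_j(z_k(x_i))$, acting on sequences by $(B_kc)_i=\sum_j b_{k,ij}c_j$. Then: 1. There are constants $K_B>0$ and $\Delta t_0>0$, independent of $\Delta x$ and $\Delta t$, such that for all $0<\Delta t\le\Delta t_0$ and all $\Delta x>0$ the matrix $B_k$ defines a bounded operator on $\ell^2(\mathbb Z)$ with $$\|B_k\|_2\le 1+K_B\,\Delta t .$$ 2. For (piecewise) linear interpolation, $p=1$, the matrix $B_k$ moreover defines a bounded operator on $\ell^\infty(\mathbb Z)$ with $\|B_k\|_\infty\le 1$ (that is, the bound holds with $K_B=0$), for all $\Delta t>0$ and $\Delta x>0$. -/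

import Mathlib

open scoped ENNReal

namespace SemiLagrangian

/-- Regularity of the velocity field: `u ∈ C²(ℝ)`, and `u`, `u'`, `u''` are bounded. -/
def H2 (u : ℝ → ℝ) : Prop :=
  ContDiff ℝ 2 u ∧ ∃ K : ℝ, ∀ p : ℕ, p ≤ 2 → ∀ x : ℝ, |iteratedDeriv p u x| ≤ K

/-- `z` is the discrete characteristic `z_k` with `k ∈ {-1, 0, 1}`: for every `x`,
`z x = x - (Δt / 2) (u x + u (z x)) + k √(6 Δt ν)`. -/
def IsDiscreteCharacteristic (u : ℝ → ℝ) (ν Δt : ℝ) (k : SignType) (z : ℝ → ℝ) : Prop :=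
  ∀ x : ℝ, z x = x - Δt / 2 * (u x + u (z x)) + (k : ℝ) * √(6 * Δt * ν)

/-- The `2r + 2` grid indices of the symmetric stencil of the cell
`[m Δx, (m + 1) Δx)` that contains `x`: `m - r, …, m + r + 1`. -/
noncomputable def stencil (r : ℕ) (Δx x : ℝ) : Finset ℤ :=
  Finset.Icc (⌊x / Δx⌋ - (r : ℤ)) (⌊x / Δx⌋ + (r : ℤ) + 1)

/-- Cardinal basis of symmetric Lagrange interpolation of odd degree `2r + 1` on the grid `ℤ Δx`:
at `x`, `ψ_j` is the Lagrange basis polynomial of the node `j Δx` with respect to the symmetric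
stencil around `x`, and `0` if `j` is not in the stencil. -/
noncomputable def lagrangeCardinal (r : ℕ) (Δx : ℝ) (j : ℤ) (x : ℝ) : ℝ :=
  if j ∈ stencil r Δx x then
    (Lagrange.basis (stencil r Δx x) (fun l : ℤ => (l : ℝ) * Δx) j).eval x
  else 0

/-- `ψ` is the cardinal spline of odd degree `2r + 1` at the node `j Δx`: the bounded function
of class `C^{2r}` which is a polynomial of degree at most `2r + 1` on every grid cell and takes the
value `1` at `j Δx` and `0` at all the other nodes. -/
structure IsCardinalSpline (r : ℕ) (Δx : ℝ) (j : ℤ) (ψ : ℝ → ℝ) : Prop where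
  contDiff : ContDiff ℝ ((2 * r : ℕ) : WithTop ℕ∞) ψ
  piecewise : ∀ m : ℤ, ∃ P : Polynomial ℝ, P.natDegree ≤ 2 * r + 1 ∧
    ∀ x ∈ Set.Icc ((m : ℝ) * Δx) (((m : ℝ) + 1) * Δx), ψ x = P.eval x
  bounded : ∃ M : ℝ, ∀ x : ℝ, |ψ x| ≤ M
  cardinal : ∀ i : ℤ, ψ ((i : ℝ) * Δx) = if i = j then 1 else 0

/-- `(ψ_j)` is the cardinal basis of symmetric Lagrange interpolation, or of spline interpolation,
of odd degree `2r + 1` on the grid `ℤ Δx`. -/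
def IsCardinalBasis (r : ℕ) (Δx : ℝ) (ψ : ℤ → ℝ → ℝ) : Prop :=
  ψ = lagrangeCardinal r Δx ∨ ∀ j : ℤ, IsCardinalSpline r Δx j (ψ j)

/-- The matrix `b_{ij} = ψ_j (z (x_i))`, with `x_i = i Δx`. -/
def interpMatrix (Δx : ℝ) (ψ : ℤ → ℝ → ℝ) (z : ℝ → ℝ) : Matrix ℤ ℤ ℝ :=
  Matrix.of fun i j => ψ j (z ((i : ℝ) * Δx))

/-- `‖B‖_p ≤ C`: the bi-infinite matrix `B` defines, through convergent sums
`(B c)_i = ∑_j b_{ij} c_j`, a bounded operator on `ℓ^p(ℤ)` whose operator norm is at most `C`. -/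
def MatrixNormLE (p : ℝ≥0∞) [Fact (1 ≤ p)] (B : Matrix ℤ ℤ ℝ) (C : ℝ) : Prop :=
  ∃ T : lp (fun _ : ℤ => ℝ) p →L[ℝ] lp (fun _ : ℤ => ℝ) p,
    (∀ (c : lp (fun _ : ℤ => ℝ) p) (i : ℤ), HasSum (fun j : ℤ => B i j * c j) (T c i)) ∧
      ‖T‖ ≤ C

end SemiLagrangian

namespace SemiLagrangian

open Polynomial MeasureTheory Set Filter Topology
open scoped FourierTransform

/-! Both bases consist of scaled translates of one function `F` on the unit grid, so the matrix
entries are `F (α i - j)` with `α i = z (x_i) / Δx`. The decisive fact is that `F` is positive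
definite. For both families the jump between neighbouring polynomial pieces is a multiple of a
single odd polynomial with alternating coefficients: `x^(2r+1)` up to sign for splines, `x ∏ (l² -
x²)` for Lagrange interpolation. Integrating by parts on every cell writes the Fourier transform of
`F` as a 1-periodic series times the nonnegative `oddSymbol`. Poisson summation and `F i = δ_{i0}`
determine that series, and the transform is `spectralDensity`, which is nonnegative
(`fourier_eq_spectralDensity`, `sum_mul_nonneg`).

Apply positive definiteness to the nodes `j` together with the points `α i`. The resulting Gram
matrix has blocks `I`, `B`, `Bᵀ` and `G`, with `G i j = F (α i - α j)`, whence `B Bᵀ ≤ G` and `‖B‖²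
≤ ‖G‖`. Since `u` is Lipschitz, the spacings of the `α i` differ from those of the grid by a
relative error `ε = O(Δt)` that does not depend on `Δx`. As `F` vanishes at nonzero integers and has
a derivative of cubic decay, the absolute row sums of `G` are `1 + O(ε)` (`exists_sum_abs_gram_le`),
and Schur's test concludes (`exists_sum_sq_le`).

The Lagrange function has compact support, but the decay of a bounded cardinal spline needs proof.
Away from the origin its pieces vanish at the nodes. The energy `∫ (p^{(r+1)})²` over a cell is the
increment of a boundary form, and by compactness the energy of `r + 1` consecutive cells controls
the first piece. This makes the boundary form contract geometrically
(`exists_decay_of_isNullChain`).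

For `p = 1` both bases are the hat function, so each row of the matrix takes a convex combination of
two entries. -/

/-- The odd polynomial `∑_{s ≤ r} (-1)^s a_s X^{2s+1}`. -/
noncomputable def alternatingOdd (r : ℕ) (a : ℕ → ℝ) : ℝ[X] :=
  ∑ s ∈ Finset.range (r + 1), C ((-1) ^ s * a s) * X ^ (2 * s + 1)

/-- `F` is a cardinal function with polynomial pieces `p m` of degree at most `2r + 1` on the
cells `[m, m + 1]`, in local coordinates, whose jumps at the integers are multiples of one
alternating odd polynomial, and which decays together with its derivatives. -/
structure IsPiecewiseCardinal (r : ℕ) (a : ℕ → ℝ) (p : ℤ → ℝ[X]) (F : ℝ → ℝ) : Prop where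
  natDegree_le : ∀ m, (p m).natDegree ≤ 2 * r + 1
  eq_eval : ∀ (m : ℤ), ∀ t ∈ Icc (0 : ℝ) 1, F (m + t) = (p m).eval t
  jump : ∀ m, ∃ c : ℝ, p m - (p (m - 1)).comp (X + 1) = C c * alternatingOdd r a
  cardinal : ∀ i : ℤ, F i = if i = 0 then 1 else 0
  decay : ∃ M : ℝ, 0 ≤ M ∧ ∀ (m : ℤ) (q : ℕ), ∀ t ∈ Icc (0 : ℝ) 1,
    |(derivative^[q] (p m)).eval t| ≤ M / (1 + |(m : ℝ)|) ^ 3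

/-! ### Exponential moments of polynomials and the symbol of the jump polynomial. -/

/-- `∑_{q < n} p^{(q)}(t) / l^{q+1}`, so that `-exp (-l t)` times it is an antiderivative of
`p(t) exp (-l t)`. -/
noncomputable def expMoment (n : ℕ) (l : ℂ) (t : ℝ) (p : ℝ[X]) : ℂ :=
  ∑ q ∈ Finset.range n, (((derivative^[q] p).eval t : ℝ) : ℂ) / l ^ (q + 1)

theorem integral_eval_mul_exp {n : ℕ} {l : ℂ} (hl : l ≠ 0) {p : ℝ[X]} (hp : p.natDegree < n) :
    ∫ t in (0 : ℝ)..1, ((p.eval t : ℝ) : ℂ) * Complex.exp (-l * t) =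
      expMoment n l 0 p - Complex.exp (-l) * expMoment n l 1 p := by
  have hder : ∀ t : ℝ, HasDerivAt (fun t : ℝ => -(Complex.exp (-l * t) * expMoment n l t p))
      (((p.eval t : ℝ) : ℂ) * Complex.exp (-l * t)) t := by
    intro t
    have h1 : HasDerivAt (fun t : ℝ => Complex.exp (-l * t)) (Complex.exp (-l * t) * (-l * 1)) t :=
      ((Complex.ofRealCLM.hasDerivAt.const_mul (-l))).cexp
    have h2 : HasDerivAt (fun t : ℝ => expMoment n l t p)
        (∑ q ∈ Finset.range n, (((derivative^[q + 1] p).eval t : ℝ) : ℂ) / l ^ (q + 1)) t := by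
      refine HasDerivAt.fun_sum fun q _ => ?_
      refine HasDerivAt.div_const ?_ _
      rw [Function.iterate_succ_apply']
      exact ((derivative^[q] p).hasDerivAt t).ofReal_comp
    refine (h1.mul h2).neg.congr_deriv ?_
    -- Differentiating shifts the sum by one index; the term of order `n` drops out because `n`
    -- exceeds the degree.
    have h3 : ∑ q ∈ Finset.range n, (((derivative^[q + 1] p).eval t : ℝ) : ℂ) / l ^ (q + 1)
        = l * expMoment n l t p - (p.eval t : ℝ) := by
      have hz : (derivative^[n] p) = 0 := iterate_derivative_eq_zero hp
      have h4 := Finset.sum_range_succ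
        (fun q => (((derivative^[q] p).eval t : ℝ) : ℂ) / l ^ q) n
      rw [Finset.sum_range_succ'] at h4
      simp only [hz, eval_zero, Complex.ofReal_zero, zero_div, add_zero, pow_zero, div_one,
        Function.iterate_zero, id] at h4
      rw [expMoment, Finset.mul_sum, eq_sub_iff_add_eq, h4]
      refine Finset.sum_congr rfl fun q _ => ?_
      rw [pow_succ]
      field_simp
    rw [h3]
    ring
  rw [intervalIntegral.integral_eq_sub_of_hasDerivAt (fun t _ => hder t)]
  · simp
    ring
  · apply Continuous.intervalIntegrable
    have := p.continuous
    fun_prop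

theorem expMoment_sub (n : ℕ) (l : ℂ) (t : ℝ) (p q : ℝ[X]) :
    expMoment n l t (p - q) = expMoment n l t p - expMoment n l t q := by
  simp [expMoment, sub_div, Finset.sum_sub_distrib]

theorem expMoment_C_mul (n : ℕ) (l : ℂ) (t c : ℝ) (p : ℝ[X]) :
    expMoment n l t (C c * p) = c * expMoment n l t p := by
  simp [expMoment, iterate_derivative_C_mul, Finset.mul_sum, mul_div_assoc]

theorem iterate_derivative_comp_X_add_one (p : ℝ[X]) (q : ℕ) :
    derivative^[q] (p.comp (X + 1)) = (derivative^[q] p).comp (X + 1) := by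
  induction q with
  | zero => rfl
  | succ q ih => simp [Function.iterate_succ_apply', ih, derivative_comp]

theorem expMoment_comp_X_add_one (n : ℕ) (l : ℂ) (p : ℝ[X]) :
    expMoment n l 0 (p.comp (X + 1)) = expMoment n l 1 p := by
  simp [expMoment, iterate_derivative_comp_X_add_one]

theorem norm_expMoment_le (n : ℕ) (l : ℂ) (t : ℝ) (p : ℝ[X]) {B : ℝ}
    (h : ∀ q, |(derivative^[q] p).eval t| ≤ B) :
    ‖expMoment n l t p‖ ≤ B * ∑ q ∈ Finset.range n, 1 / ‖l‖ ^ (q + 1) := by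
  rw [expMoment, Finset.mul_sum]
  refine (norm_sum_le _ _).trans (Finset.sum_le_sum fun q _ => ?_)
  rw [norm_div, norm_pow, Complex.norm_real, Real.norm_eq_abs, mul_one_div]
  gcongr
  exact h q

/-- The (positive) transform `∑_{s ≤ r} a_s (2s+1)! / (2πξ)^{2s+2}` of the odd polynomial. -/
noncomputable def oddSymbol (r : ℕ) (a : ℕ → ℝ) (ξ : ℝ) : ℝ :=
  ∑ s ∈ Finset.range (r + 1), a s * (2 * s + 1).factorial / (2 * Real.pi * ξ) ^ (2 * s + 2)

/-- At `0` only the derivative of order `2s + 1` of `X^(2s+1)` survives, and `I^(2s+2) = (-1)^(s+1)`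
cancels the alternating sign. All terms thus get the same sign, which is the source of positive
definiteness. -/
theorem expMoment_alternatingOdd (r : ℕ) (a : ℕ → ℝ) {ξ : ℝ} (hξ : ξ ≠ 0) :
    expMoment (2 * r + 2) (2 * Real.pi * ξ * Complex.I) 0 (alternatingOdd r a) =
      -(oddSymbol r a ξ : ℂ) := by
  have key : ∀ s ∈ Finset.range (r + 1),
      expMoment (2 * r + 2) (2 * Real.pi * ξ * Complex.I) 0
        (C ((-1) ^ s * a s) * X ^ (2 * s + 1)) =
      -((a s * (2 * s + 1).factorial / (2 * Real.pi * ξ) ^ (2 * s + 2) : ℝ) : ℂ) := by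
    intro s hs
    rw [Finset.mem_range] at hs
    rw [expMoment, Finset.sum_eq_single (2 * s + 1)]
    · rw [iterate_derivative_C_mul, iterate_derivative_X_pow_eq_natCast_mul]
      have : (2 * (Real.pi : ℂ) * ξ * Complex.I) ^ (2 * s + 1 + 1) =
          (-1) ^ (s + 1) * (2 * Real.pi * ξ) ^ (2 * s + 2) := by
        rw [mul_pow, show 2 * s + 1 + 1 = 2 * (s + 1) by ring, pow_mul Complex.I, Complex.I_sq]
        ring
      rw [this, Nat.descFactorial_self, Nat.sub_self, pow_zero]
      have hp : (2 * (Real.pi : ℂ) * ξ) ≠ 0 := by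
        simp [hξ, Real.pi_ne_zero]
      have h1 : ((-1 : ℂ) ^ (s + 1)) ≠ 0 := by simp
      push_cast
      simp only [mul_one]
      rw [div_eq_iff (mul_ne_zero h1 (pow_ne_zero _ hp))]
      field_simp
      simp
      ring
    · intro q _ hq
      rw [iterate_derivative_C_mul, iterate_derivative_X_pow_eq_natCast_mul]
      rcases lt_or_gt_of_ne hq with h | h
      · simp [show 2 * s + 1 - q ≠ 0 by omega]
      · rw [Nat.descFactorial_of_lt h]
        simp
    · intro h
      exact absurd (Finset.mem_range.2 (by omega)) h
  have hlin : ∀ S : Finset ℕ, ∀ f : ℕ → ℝ[X], ∀ (n : ℕ) (l : ℂ),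
      expMoment n l 0 (∑ s ∈ S, f s) = ∑ s ∈ S, expMoment n l 0 (f s) := by
    intro S f n l
    simp only [expMoment, iterate_derivative_sum, eval_finsetSum, Complex.ofReal_sum,
      Finset.sum_div]
    rw [Finset.sum_comm]
  rw [alternatingOdd, hlin, Finset.sum_congr rfl key, oddSymbol]
  push_cast
  rw [Finset.sum_neg_distrib]

theorem oddSymbol_nonneg {r : ℕ} {a : ℕ → ℝ} (ha : ∀ s, 0 ≤ a s) (ξ : ℝ) :
    0 ≤ oddSymbol r a ξ := by
  refine Finset.sum_nonneg fun s _ => ?_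
  have := ha s
  have : 0 ≤ (2 * Real.pi * ξ) ^ (2 * s + 2) := by
    rw [show 2 * s + 2 = 2 * (s + 1) by ring]
    exact (even_two_mul _).pow_nonneg _
  positivity

theorem oddSymbol_le {r : ℕ} {a : ℕ → ℝ} (ha : ∀ s, 0 ≤ a s) {ξ : ℝ} (hξ : 1 ≤ |ξ|) :
    oddSymbol r a ξ ≤ (∑ s ∈ Finset.range (r + 1), a s * (2 * s + 1).factorial) / ξ ^ 2 := by
  rw [oddSymbol, Finset.sum_div]
  refine Finset.sum_le_sum fun s _ => ?_
  have h0 := ha s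
  have h1 : (2 * Real.pi * ξ) ^ (2 * s + 2) = |2 * Real.pi * ξ| ^ (2 * s + 2) := by
    rw [show 2 * s + 2 = 2 * (s + 1) by ring, Even.pow_abs (even_two_mul _)]
  have h2 : |ξ| ≤ |2 * Real.pi * ξ| := by
    rw [abs_mul]
    have : 1 ≤ |2 * Real.pi| := by
      rw [abs_of_pos Real.two_pi_pos]
      linarith [Real.pi_gt_three]
    nlinarith
  have h3 : ξ ^ 2 ≤ (2 * Real.pi * ξ) ^ (2 * s + 2) := by
    rw [h1, ← sq_abs ξ]
    calc |ξ| ^ 2 ≤ |ξ| ^ (2 * s + 2) := pow_le_pow_right₀ hξ (by omega)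
      _ ≤ _ := pow_le_pow_left₀ (abs_nonneg _) h2 _
  have h4 : 0 < ξ ^ 2 := by rw [← sq_abs]; positivity
  gcongr

theorem summable_oddSymbol (r : ℕ) (a : ℕ → ℝ) (ξ : ℝ) :
    Summable fun k : ℤ => oddSymbol r a (k + ξ) := by
  refine summable_sum fun s _ => ?_
  have h := (Real.summable_one_div_int_add_rpow ξ (2 * s + 2 : ℕ)).2 (by
    push_cast
    linarith [(Nat.cast_nonneg s : (0 : ℝ) ≤ s)])
  refine (h.mul_left (a s * (2 * s + 1).factorial / (2 * Real.pi) ^ (2 * s + 2))).congr fun k => ?_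
  rw [Real.rpow_natCast, show 2 * s + 2 = 2 * (s + 1) by ring, Even.pow_abs (even_two_mul _),
    mul_pow (2 * Real.pi)]
  rw [div_mul_div_comm, mul_one]

/-! ### The Fourier transform of a piecewise cardinal function. -/

theorem summable_one_div_one_add_abs_int : Summable fun m : ℤ => 1 / (1 + |(m : ℝ)|) ^ 3 := by
  have h : Summable fun m : ℤ => 1 / (m : ℝ) ^ 2 := Real.summable_one_div_int_pow.2 one_lt_two
  refine Summable.of_norm_bounded_eventually h ?_
  have : ({0}ᶜ : Set ℤ) ∈ cofinite := (finite_singleton 0).compl_mem_cofinite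
  filter_upwards [this] with m hm
  have hm : 0 < |(m : ℝ)| := by simpa using hm
  rw [Real.norm_of_nonneg (by positivity), ← sq_abs]
  gcongr 1 / ?_
  nlinarith [pow_pos hm 3, pow_pos hm 2]

namespace IsPiecewiseCardinal

variable {r : ℕ} {a : ℕ → ℝ} {p : ℤ → ℝ[X]} {F : ℝ → ℝ}

theorem eq_eval_floor (h : IsPiecewiseCardinal r a p F) (x : ℝ) :
    F x = (p ⌊x⌋).eval (Int.fract x) := by
  rw [← h.eq_eval ⌊x⌋ _ ⟨Int.fract_nonneg x, (Int.fract_lt_one x).le⟩, Int.floor_add_fract]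

theorem continuousOn_Icc (h : IsPiecewiseCardinal r a p F) (m : ℤ) :
    ContinuousOn F (Icc (m : ℝ) (m + 1)) := by
  have h1 : ContinuousOn (fun x : ℝ => (p m).eval (x - m)) (Icc (m : ℝ) (m + 1)) := by
    have := (p m).continuous
    fun_prop
  refine h1.congr fun x hx => ?_
  have := h.eq_eval m (x - m) ⟨by linarith [hx.1], by linarith [hx.2]⟩
  simpa using this

theorem continuous (h : IsPiecewiseCardinal r a p F) : Continuous F := by
  rw [continuous_iff_continuousAt]
  intro x
  rw [continuousAt_iff_continuous_left_right]
  constructor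
  · have h1 : x ∈ Ioc ((⌈x⌉ - 1 : ℤ) : ℝ) ((⌈x⌉ - 1 : ℤ) + 1) := by
      push_cast
      exact ⟨by linarith [Int.ceil_lt_add_one x], by linarith [Int.le_ceil x]⟩
    exact (h.continuousOn_Icc _ x (Ioc_subset_Icc_self h1)).mono_of_mem_nhdsWithin
      (mem_of_superset (Icc_mem_nhdsLE h1.1) (Icc_subset_Icc_right h1.2))
  · have h1 : x ∈ Ico (⌊x⌋ : ℝ) (⌊x⌋ + 1) := ⟨Int.floor_le x, Int.lt_floor_add_one x⟩
    exact (h.continuousOn_Icc _ x (Ico_subset_Icc_self h1)).mono_of_mem_nhdsWithin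
      (mem_of_superset (Icc_mem_nhdsGE h1.2) (Icc_subset_Icc_left h1.1))

theorem exists_abs_le (h : IsPiecewiseCardinal r a p F) :
    ∃ M : ℝ, 0 ≤ M ∧ ∀ x, |F x| ≤ M / (1 + |(⌊x⌋ : ℝ)|) ^ 3 := by
  obtain ⟨M, hM, hd⟩ := h.decay
  refine ⟨M, hM, fun x => ?_⟩
  rw [h.eq_eval_floor]
  exact hd ⌊x⌋ 0 _ ⟨Int.fract_nonneg x, (Int.fract_lt_one x).le⟩

theorem abs_le_one_add_abs_floor (x : ℝ) : |x| ≤ 1 + |(⌊x⌋ : ℝ)| := by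
  have h1 := Int.floor_add_fract x
  have h2 : |Int.fract x| ≤ 1 := by
    rw [abs_of_nonneg (Int.fract_nonneg x)]
    exact (Int.fract_lt_one x).le
  calc |x| = |(⌊x⌋ : ℝ) + Int.fract x| := by rw [h1]
    _ ≤ _ := (abs_add_le _ _).trans (by linarith)

theorem exists_abs_le_inv (h : IsPiecewiseCardinal r a p F) :
    ∃ M : ℝ, 0 ≤ M ∧ ∀ x, |F x| ≤ M * (1 + x ^ 2)⁻¹ := by
  obtain ⟨M, hM, hd⟩ := h.exists_abs_le
  refine ⟨M * 2, by positivity, fun x => (hd x).trans ?_⟩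
  rw [mul_assoc, div_eq_mul_inv]
  gcongr
  rw [← div_eq_mul_inv, ← inv_div]
  gcongr
  have h1 := abs_le_one_add_abs_floor x
  have h2 := abs_nonneg (⌊x⌋ : ℝ)
  have h3 : x ^ 2 ≤ (1 + |(⌊x⌋ : ℝ)|) ^ 2 := by
    rw [← sq_abs x]
    gcongr
  nlinarith [pow_nonneg h2 2, pow_nonneg h2 3]

theorem continuous_ofReal (h : IsPiecewiseCardinal r a p F) :
    Continuous fun x => (F x : ℂ) :=
  Complex.continuous_ofReal.comp h.continuous

theorem integrable (h : IsPiecewiseCardinal r a p F) : Integrable fun x => (F x : ℂ) := by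
  obtain ⟨M, hM, hd⟩ := h.exists_abs_le_inv
  refine (integrable_inv_one_add_sq.const_mul M).mono' h.continuous_ofReal.aestronglyMeasurable
    (Eventually.of_forall fun x => ?_)
  simpa using hd x

/-- The derivative of order `2r + 1` of the jump polynomial at `0` is a nonzero constant because `a
r > 0`. Comparing top derivatives therefore bounds each factor by the decay of the two adjacent
pieces. -/
theorem exists_jump (h : IsPiecewiseCardinal r a p F) (har : 0 < a r) :
    ∃ c : ℤ → ℝ, (∀ m, p m - (p (m - 1)).comp (X + 1) = C (c m) * alternatingOdd r a) ∧
      Summable fun m => |c m| := by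
  choose c hc using h.jump
  refine ⟨c, hc, ?_⟩
  obtain ⟨M, hM, hd⟩ := h.decay
  have hW : (derivative^[2 * r + 1] (alternatingOdd r a)).eval 0 =
      (-1) ^ r * a r * (2 * r + 1).factorial := by
    rw [alternatingOdd, iterate_derivative_sum, eval_finsetSum, Finset.sum_eq_single r]
    · rw [iterate_derivative_C_mul, iterate_derivative_X_pow_eq_natCast_mul,
        Nat.descFactorial_self, Nat.sub_self, pow_zero]
      simp
    · intro s hs hsr
      rw [Finset.mem_range] at hs
      rw [iterate_derivative_C_mul, iterate_derivative_X_pow_eq_natCast_mul,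
        Nat.descFactorial_of_lt (by omega)]
      simp
    · simp
  set D : ℝ := a r * (2 * r + 1).factorial with hD
  have hDpos : 0 < D := by positivity
  have key : ∀ m, |c m| * D ≤ M / (1 + |(m : ℝ)|) ^ 3 + M / (1 + |((m - 1 : ℤ) : ℝ)|) ^ 3 := by
    intro m
    have h1 := congrArg (fun q => (derivative^[2 * r + 1] q).eval 0) (hc m)
    simp only [iterate_derivative_sub, iterate_derivative_C_mul, eval_sub, eval_mul, eval_C, hW,
      iterate_derivative_comp_X_add_one, eval_comp, eval_add, eval_X, eval_one, zero_add] at h1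
    have h2 : |c m| * D = |c m * ((-1) ^ r * a r * (2 * r + 1).factorial)| := by
      rw [mul_assoc ((-1 : ℝ) ^ r), ← hD]
      simp [abs_mul, abs_of_pos hDpos]
    rw [h2, ← h1]
    exact (abs_sub _ _).trans (add_le_add (hd m _ 0 (by simp)) (hd (m - 1) _ 1 (by simp)))
  have hs := summable_one_div_one_add_abs_int.mul_left M
  have hs' := (Equiv.subRight (1 : ℤ)).summable_iff.2 hs
  refine Summable.of_nonneg_of_le (fun m => abs_nonneg _) (fun m => ?_) ((hs.add hs').mul_right D⁻¹)
  rw [← div_eq_mul_inv, le_div_iff₀ hDpos]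
  simpa [div_eq_mul_inv] using key m

/-- Each cell contributes two boundary terms. Re-indexing pairs the right end of cell `m - 1` with
the left end of cell `m`, so that only the jumps remain. -/
theorem integral_mul_exp_eq_tsum (h : IsPiecewiseCardinal r a p F) {c : ℤ → ℝ}
    (hc : ∀ m, p m - (p (m - 1)).comp (X + 1) = C (c m) * alternatingOdd r a) {l : ℂ}
    (hl0 : l ≠ 0) (hlre : ∀ x : ℝ, ‖Complex.exp (-l * x)‖ = 1) :
    ∫ x : ℝ, (F x : ℂ) * Complex.exp (-l * x) =
      ∑' m : ℤ, (c m : ℂ) * Complex.exp (-l * m) *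
        expMoment (2 * r + 2) l 0 (alternatingOdd r a) := by
  have hint : Integrable fun x : ℝ => (F x : ℂ) * Complex.exp (-l * x) := by
    refine h.integrable.mul_bdd (c := 1) ?_ (Eventually.of_forall fun x => (hlre x).le)
    exact Continuous.aestronglyMeasurable (by fun_prop)
  have h1 := hint.hasSum_intervalIntegral_comp_add_int
  let A : ℤ → ℂ := fun m => Complex.exp (-l * m) * expMoment (2 * r + 2) l 0 (p m)
  let B : ℤ → ℂ := fun m => Complex.exp (-l * m) * expMoment (2 * r + 2) l 1 (p (m - 1))
  have h2 : ∀ m : ℤ, ∫ x in (0 : ℝ)..1, (F (x + m) : ℂ) * Complex.exp (-l * ((x + m : ℝ) : ℂ)) =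
      A m - B (m + 1) := by
    intro m
    have : ∀ x ∈ uIcc (0 : ℝ) 1, (F (x + m) : ℂ) * Complex.exp (-l * ((x + m : ℝ) : ℂ)) =
        Complex.exp (-l * m) * (((p m).eval x : ℝ) * Complex.exp (-l * x)) := by
      intro x hx
      rw [uIcc_of_le zero_le_one] at hx
      rw [add_comm x, h.eq_eval m x hx]
      push_cast
      rw [mul_add, Complex.exp_add]
      ring
    rw [intervalIntegral.integral_congr this, intervalIntegral.integral_const_mul,
      integral_eval_mul_exp hl0 (Nat.lt_succ_of_le (h.natDegree_le m))]
    simp only [A, B, add_sub_cancel_right]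
    push_cast
    rw [mul_add (-l), Complex.exp_add, mul_one]
    ring
  rw [funext h2] at h1
  obtain ⟨M, hM, hd⟩ := h.decay
  have hw := summable_one_div_one_add_abs_int
  obtain ⟨K, hK⟩ : ∃ K, K = M * ∑ q ∈ Finset.range (2 * r + 2), 1 / ‖l‖ ^ (q + 1) := ⟨_, rfl⟩
  have hexp : ∀ m : ℤ, ‖Complex.exp (-l * m)‖ = 1 := fun m => by
    simpa using hlre (m : ℝ)
  have hb : ∀ (m : ℤ) (t : ℝ), t ∈ Icc (0 : ℝ) 1 → ‖expMoment (2 * r + 2) l t (p m)‖ ≤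
      K * (1 / (1 + |(m : ℝ)|) ^ 3) := fun m t ht =>
    (norm_expMoment_le _ l t (p m) fun q => hd m q t ht).trans (le_of_eq (by rw [hK]; ring))
  have hAs : Summable A := Summable.of_norm_bounded (hw.mul_left K) fun m => by
    rw [norm_mul, hexp, one_mul]
    exact hb m 0 (by simp)
  have hBs : Summable B := by
    refine Summable.of_norm_bounded
      (g := fun m : ℤ => K * (1 / (1 + |((m - 1 : ℤ) : ℝ)|) ^ 3)) ?_ fun m => ?_
    · exact ((Equiv.subRight (1 : ℤ)).summable_iff.2 hw).mul_left K
    · rw [norm_mul, hexp, one_mul]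
      exact hb (m - 1) 1 (by simp)
  have hBs' : HasSum (fun m => B (m + 1)) (∑' m, B m) :=
    ((Equiv.addRight (1 : ℤ)).hasSum_iff (f := B)).2 hBs.hasSum
  rw [h1.unique (hAs.hasSum.sub hBs'), ← hAs.tsum_sub hBs]
  refine tsum_congr fun m => ?_
  simp only [A, B]
  rw [← mul_sub, ← expMoment_comp_X_add_one, ← expMoment_sub, hc, expMoment_C_mul]
  ring

/-- The Fourier transform of a piecewise cardinal function, through the jumps of its pieces. -/
theorem fourier_eq_tsum (h : IsPiecewiseCardinal r a p F) {c : ℤ → ℝ}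
    (hc : ∀ m, p m - (p (m - 1)).comp (X + 1) = C (c m) * alternatingOdd r a) {ξ : ℝ}
    (hξ : ξ ≠ 0) :
    𝓕 (fun x => (F x : ℂ)) ξ =
      -(∑' m : ℤ, (c m : ℂ) * Complex.exp (-(2 * Real.pi * ξ * Complex.I) * m)) *
        oddSymbol r a ξ := by
  have hl0 : (2 * Real.pi * ξ * Complex.I : ℂ) ≠ 0 := by simp [hξ, Real.pi_ne_zero]
  have hlre : ∀ x : ℝ, ‖Complex.exp (-(2 * Real.pi * ξ * Complex.I : ℂ) * x)‖ = 1 := by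
    intro x
    rw [show -(2 * (Real.pi : ℂ) * ξ * Complex.I) * x =
      ((-(2 * Real.pi * ξ * x) : ℝ) : ℂ) * Complex.I by push_cast; ring]
    exact Complex.norm_exp_ofReal_mul_I _
  have hF : 𝓕 (fun x => (F x : ℂ)) ξ =
      ∫ x : ℝ, (F x : ℂ) * Complex.exp (-(2 * Real.pi * ξ * Complex.I : ℂ) * x) := by
    rw [Real.fourier_real_eq_integral_exp_smul]
    refine integral_congr_ae (Eventually.of_forall fun x => ?_)
    simp only [smul_eq_mul]
    rw [mul_comm]
    congr 2
    push_cast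
    ring
  rw [hF, h.integral_mul_exp_eq_tsum hc hl0 hlre, expMoment_alternatingOdd r a hξ, tsum_mul_right]
  ring

end IsPiecewiseCardinal

/-! ### Poisson summation, the spectral density and positive definiteness. -/

/-- The spectral density `oddSymbol ξ / ∑ₖ oddSymbol (k + ξ)` of the cardinal function. -/
noncomputable def spectralDensity (r : ℕ) (a : ℕ → ℝ) (ξ : ℝ) : ℝ :=
  oddSymbol r a ξ / ∑' k : ℤ, oddSymbol r a (k + ξ)

theorem spectralDensity_nonneg {r : ℕ} {a : ℕ → ℝ} (ha : ∀ s, 0 ≤ a s) (ξ : ℝ) :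
    0 ≤ spectralDensity r a ξ :=
  div_nonneg (oddSymbol_nonneg ha ξ) (tsum_nonneg fun _ => oddSymbol_nonneg ha _)

namespace IsPiecewiseCardinal

variable {r : ℕ} {a : ℕ → ℝ} {p : ℤ → ℝ[X]} {F : ℝ → ℝ}

/-- Poisson summation for `F` modulated by the frequency `ξ`: on the space side only the sample at
`0` survives. -/
theorem tsum_fourier_eq_one (h : IsPiecewiseCardinal r a p F) {ξ : ℝ}
    (hs : Summable fun k : ℤ => 𝓕 (fun x => (F x : ℂ)) (k + ξ)) :
    ∑' k : ℤ, 𝓕 (fun x => (F x : ℂ)) (k + ξ) = 1 := by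
  let f : ℝ → ℂ := fun x => Complex.exp ((-(2 * Real.pi * ξ * x) : ℝ) * Complex.I) * F x
  have hf : Continuous f := by
    have := h.continuous_ofReal
    fun_prop
  have hF : ∀ k : ℝ, 𝓕 f k = 𝓕 (fun x => (F x : ℂ)) (k + ξ) := by
    intro k
    rw [Real.fourier_real_eq_integral_exp_smul, Real.fourier_real_eq_integral_exp_smul]
    refine integral_congr_ae (Eventually.of_forall fun x => ?_)
    simp only [smul_eq_mul, f]
    rw [← mul_assoc, ← Complex.exp_add]
    congr 2
    push_cast
    ring
  have hdec : f =O[cocompact ℝ] fun x : ℝ => |x| ^ (-2 : ℝ) := by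
    obtain ⟨M, hM, hd⟩ := h.exists_abs_le_inv
    refine Asymptotics.IsBigO.of_bound M ?_
    have : ({0}ᶜ : Set ℝ) ∈ cocompact ℝ := (isCompact_singleton).compl_mem_cocompact
    filter_upwards [this] with x hx
    have hx : x ≠ 0 := hx
    simp only [f]
    rw [norm_mul, Complex.norm_exp_ofReal_mul_I, one_mul, Complex.norm_real, Real.norm_eq_abs,
      Real.norm_of_nonneg (by positivity), Real.rpow_neg (abs_nonneg x)]
    refine (hd x).trans ?_
    have : |x| ^ (2 : ℝ) = x ^ 2 := by
      rw [show (2 : ℝ) = (2 : ℕ) by norm_num, Real.rpow_natCast, sq_abs]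
    rw [this]
    gcongr
    linarith
  have key := Real.tsum_eq_tsum_fourier_of_rpow_decay_of_summable hf one_lt_two hdec
    (by simpa only [hF] using hs) 0
  have h1 : ∀ n : ℤ, f (0 + n) = if n = 0 then 1 else 0 := by
    intro n
    simp only [f, zero_add, h.cardinal]
    split_ifs with hn <;> simp [hn]
  have hz : ((0 : ℝ) : UnitAddCircle) = 0 := by simp
  simp only [h1, hF, tsum_ite_eq, hz, fourier_eval_zero, mul_one] at key
  exact key.symm

/-- The jump series is 1-periodic in `ξ`, so it factors out of the sum over integer shifts; that
this sum equals `1` determines it. Integers `ξ` are excluded because the jump formula fails at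
frequency `0`. -/
theorem fourier_eq_spectralDensity (h : IsPiecewiseCardinal r a p F)
    (har : 0 < a r) {ξ : ℝ} (hξ : ∀ k : ℤ, (k : ℝ) + ξ ≠ 0) :
    𝓕 (fun x => (F x : ℂ)) ξ = spectralDensity r a ξ := by
  obtain ⟨c, hc, -⟩ := h.exists_jump har
  set S : ℂ := ∑' m : ℤ, (c m : ℂ) * Complex.exp (-(2 * Real.pi * ξ * Complex.I) * m) with hS
  have hper : ∀ k : ℤ, 𝓕 (fun x => (F x : ℂ)) (k + ξ) = -S * (oddSymbol r a (k + ξ) : ℝ) := by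
    intro k
    rw [h.fourier_eq_tsum hc (hξ k), hS]
    congr 2
    refine tsum_congr fun m => ?_
    congr 1
    rw [Complex.exp_eq_exp_iff_exists_int]
    refine ⟨-(k * m), ?_⟩
    push_cast
    ring
  have hg := summable_oddSymbol r a ξ
  have hgc : Summable fun k : ℤ => -S * ((oddSymbol r a (k + ξ) : ℝ) : ℂ) :=
    (Complex.ofRealCLM.summable hg).mul_left _
  have h1 := h.tsum_fourier_eq_one (ξ := ξ) (by simpa only [hper] using hgc)
  simp only [hper] at h1
  rw [tsum_mul_left, ← Complex.ofReal_tsum] at h1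
  have h0 := hper 0
  simp only [Int.cast_zero, zero_add] at h0
  rw [h0, spectralDensity, Complex.ofReal_div, eq_div_iff, mul_right_comm, h1, one_mul]
  intro hz
  rw [hz, mul_zero] at h1
  exact zero_ne_one h1

theorem fourier_ae_eq (h : IsPiecewiseCardinal r a p F) (har : 0 < a r) :
    𝓕 (fun x => (F x : ℂ)) =ᵐ[volume] fun ξ => ((spectralDensity r a ξ : ℝ) : ℂ) := by
  have hcount : (range fun k : ℤ => -(k : ℝ)).Countable := countable_range _
  filter_upwards [compl_mem_ae_iff.2 (hcount.measure_zero volume)] with ξ hξ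
  refine h.fourier_eq_spectralDensity har fun k hk => hξ ⟨k, ?_⟩
  simp only
  linarith

theorem integrable_fourier (h : IsPiecewiseCardinal r a p F) (ha : ∀ s, 0 ≤ a s)
    (har : 0 < a r) : Integrable (𝓕 fun x => (F x : ℂ)) := by
  obtain ⟨c, hc, hcs⟩ := h.exists_jump har
  set K := ∑ s ∈ Finset.range (r + 1), a s * (2 * s + 1).factorial with hK
  have hK0 : 0 ≤ K := Finset.sum_nonneg fun s _ => mul_nonneg (ha s) (Nat.cast_nonneg _)
  set I := ∫ x, ‖(F x : ℂ)‖
  have hI0 : 0 ≤ I := integral_nonneg fun _ => norm_nonneg _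
  set T := ∑' m, |c m|
  have hT0 : 0 ≤ T := tsum_nonneg fun _ => abs_nonneg _
  have hcont : Continuous (𝓕 fun x => (F x : ℂ)) :=
    VectorFourier.fourierIntegral_continuous Real.continuous_fourierChar
      (by exact continuous_inner) h.integrable
  -- The summand `2 I` covers `|ξ| < 1` through the `L¹` norm of `F`, and `2 T K` covers `|ξ| ≥ 1`
  -- through the bound `T K / ξ²`.
  refine (integrable_inv_one_add_sq.const_mul (2 * I + 2 * T * K)).mono'
    hcont.aestronglyMeasurable (Eventually.of_forall fun ξ => ?_)
  rw [← div_eq_mul_inv, le_div_iff₀ (by positivity)]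
  rcases le_or_gt 1 |ξ| with h1 | h1
  · have hξ : ξ ≠ 0 := by
      rintro rfl
      norm_num at h1
    have hsq : 1 ≤ ξ ^ 2 := by rw [← sq_abs]; nlinarith
    have hsum : ‖∑' m : ℤ, (c m : ℂ) * Complex.exp (-(2 * Real.pi * ξ * Complex.I) * m)‖ ≤ T := by
      have hn : ∀ m : ℤ, ‖(c m : ℂ) * Complex.exp (-(2 * Real.pi * ξ * Complex.I) * m)‖ =
          |c m| := fun m => by
        rw [norm_mul, Complex.norm_real, Real.norm_eq_abs,
          show -(2 * (Real.pi : ℂ) * ξ * Complex.I) * m =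
            ((-(2 * Real.pi * ξ * m) : ℝ) : ℂ) * Complex.I by push_cast; ring,
          Complex.norm_exp_ofReal_mul_I, mul_one]
      refine (norm_tsum_le_tsum_norm (by simpa only [hn] using hcs)).trans (le_of_eq ?_)
      exact tsum_congr hn
    rw [h.fourier_eq_tsum hc hξ, norm_mul, norm_neg, Complex.norm_real,
      Real.norm_of_nonneg (oddSymbol_nonneg ha ξ)]
    have h2 := oddSymbol_le (r := r) ha h1
    rw [← hK, le_div_iff₀ (by positivity)] at h2
    have h3 := oddSymbol_nonneg (r := r) ha ξ
    calc _ ≤ T * oddSymbol r a ξ * (2 * ξ ^ 2) := by gcongr; linarith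
      _ = 2 * T * (oddSymbol r a ξ * ξ ^ 2) := by ring
      _ ≤ 2 * T * K := by gcongr
      _ ≤ _ := by linarith
  · have h2 : ‖𝓕 (fun x => (F x : ℂ)) ξ‖ ≤ I :=
      VectorFourier.norm_fourierIntegral_le_integral_norm _ _ _ _ _
    have h3 : ξ ^ 2 ≤ 1 := by rw [← sq_abs]; nlinarith [abs_nonneg ξ]
    have h4 : 0 ≤ 2 * T * K := by positivity
    calc _ ≤ I * (1 + 1) := by gcongr
      _ ≤ _ := by linarith

theorem integrable_spectralDensity (h : IsPiecewiseCardinal r a p F) (ha : ∀ s, 0 ≤ a s)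
    (har : 0 < a r) : Integrable (spectralDensity r a) := by
  have := ((integrable_congr (h.fourier_ae_eq har)).1 (h.integrable_fourier ha har)).re
  simpa using this

/-- A piecewise cardinal function is the cosine transform of its nonnegative spectral density. -/
theorem eq_integral_cos (h : IsPiecewiseCardinal r a p F) (ha : ∀ s, 0 ≤ a s) (har : 0 < a r)
    (x : ℝ) : F x = ∫ ξ, spectralDensity r a ξ * Real.cos (2 * Real.pi * ξ * x) := by
  have h1 := congrFun (h.continuous_ofReal.fourierInv_fourier_eq h.integrable
    (h.integrable_fourier ha har)) x
  rw [Real.fourierInv_eq'] at h1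
  have h2 : ∫ ξ, Complex.exp ((2 * Real.pi * inner ℝ ξ x : ℝ) * Complex.I) •
        𝓕 (fun x => (F x : ℂ)) ξ =
      ∫ ξ, Complex.exp ((2 * Real.pi * inner ℝ ξ x : ℝ) * Complex.I) •
        ((spectralDensity r a ξ : ℝ) : ℂ) := by
    refine integral_congr_ae ?_
    filter_upwards [h.fourier_ae_eq har] with ξ hξ
    rw [hξ]
  rw [h2] at h1
  have hint : Integrable fun ξ => Complex.exp ((2 * Real.pi * inner ℝ ξ x : ℝ) * Complex.I) •
        ((spectralDensity r a ξ : ℝ) : ℂ) := by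
    refine ((h.integrable_spectralDensity ha har).ofReal (𝕜 := ℂ)).bdd_mul (c := 1) ?_ ?_
    · exact Continuous.aestronglyMeasurable (by fun_prop)
    · exact Eventually.of_forall fun ξ => (Complex.norm_exp_ofReal_mul_I _).le
  have h3 := congrArg Complex.re h1
  rw [← Complex.reCLM_apply, ← ContinuousLinearMap.integral_comp_comm _ hint] at h3
  rw [Complex.ofReal_re] at h3
  rw [← h3]
  refine integral_congr_ae (Eventually.of_forall fun ξ => ?_)
  simp only [Complex.reCLM_apply, smul_eq_mul, Complex.re_mul_ofReal, Complex.exp_ofReal_mul_I_re]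
  rw [mul_comm]
  congr 2
  simp
  ring

/-- The spectral density depends only on `r` and `a`. This gives uniqueness of the bounded cardinal
spline. -/
theorem eq_of_isPiecewiseCardinal (h : IsPiecewiseCardinal r a p F) (ha : ∀ s, 0 ≤ a s)
    (har : 0 < a r) {p' : ℤ → ℝ[X]} {F' : ℝ → ℝ} (h' : IsPiecewiseCardinal r a p' F') :
    F = F' := by
  funext x
  rw [h.eq_integral_cos ha har, h'.eq_integral_cos ha har]

theorem map_neg (h : IsPiecewiseCardinal r a p F) (ha : ∀ s, 0 ≤ a s) (har : 0 < a r)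
    (x : ℝ) : F (-x) = F x := by
  rw [h.eq_integral_cos ha har, h.eq_integral_cos ha har]
  simp

/-- A piecewise cardinal function is positive definite. -/
theorem sum_mul_nonneg (h : IsPiecewiseCardinal r a p F) (ha : ∀ s, 0 ≤ a s) (har : 0 < a r)
    {ι : Type*} (s : Finset ι) (y c : ι → ℝ) :
    0 ≤ ∑ i ∈ s, ∑ j ∈ s, c i * c j * F (y i - y j) := by
  have hint : ∀ x, Integrable fun ξ => spectralDensity r a ξ * Real.cos (2 * Real.pi * ξ * x) := by
    intro x
    refine (h.integrable_spectralDensity ha har).mul_bdd (c := 1) ?_ ?_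
    · exact Continuous.aestronglyMeasurable (by fun_prop)
    · exact Eventually.of_forall fun ξ => Real.abs_cos_le_one _
  have key : ∑ i ∈ s, ∑ j ∈ s, c i * c j * F (y i - y j) =
      ∫ ξ, ∑ i ∈ s, ∑ j ∈ s, c i * c j *
        (spectralDensity r a ξ * Real.cos (2 * Real.pi * ξ * (y i - y j))) := by
    rw [integral_finsetSum _ fun i _ => integrable_finsetSum _ fun j _ => (hint _).const_mul _]
    refine Finset.sum_congr rfl fun i _ => ?_
    rw [integral_finsetSum _ fun j _ => (hint _).const_mul _]
    refine Finset.sum_congr rfl fun j _ => ?_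
    rw [integral_const_mul, ← h.eq_integral_cos ha har]
  rw [key]
  refine integral_nonneg fun ξ => ?_
  -- The integrand is the density times `|∑ c_i exp (2πi ξ y_i)|²`, written with real and imaginary
  -- parts.
  have : ∑ i ∈ s, ∑ j ∈ s, c i * c j *
        (spectralDensity r a ξ * Real.cos (2 * Real.pi * ξ * (y i - y j))) =
      spectralDensity r a ξ * ((∑ i ∈ s, c i * Real.cos (2 * Real.pi * ξ * y i)) ^ 2 +
        (∑ i ∈ s, c i * Real.sin (2 * Real.pi * ξ * y i)) ^ 2) := by
    rw [sq, sq, Finset.sum_mul_sum, Finset.sum_mul_sum, ← Finset.sum_add_distrib, Finset.mul_sum]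
    refine Finset.sum_congr rfl fun i _ => ?_
    rw [← Finset.sum_add_distrib, Finset.mul_sum]
    refine Finset.sum_congr rfl fun j _ => ?_
    rw [mul_sub, Real.cos_sub]
    ring
  simp only [Pi.zero_apply]
  rw [this]
  exact mul_nonneg (spectralDensity_nonneg ha ξ) (by positivity)

end IsPiecewiseCardinal

/-! ### The Gram matrix of perturbed grid points and the `ℓ²` bound. -/

namespace IsPiecewiseCardinal

variable {r : ℕ} {a : ℕ → ℝ} {p : ℤ → ℝ[X]} {F : ℝ → ℝ}

/-- Only a right derivative is available: the Lagrange function may have kinks at the nodes.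
One-sided derivatives suffice for the mean value inequality. -/
theorem hasDerivWithinAt (h : IsPiecewiseCardinal r a p F) (x : ℝ) :
    HasDerivWithinAt F ((derivative (p ⌊x⌋)).eval (Int.fract x)) (Ici x) x := by
  have h1 : HasDerivAt (fun y : ℝ => (p ⌊x⌋).eval (y - ⌊x⌋))
      ((derivative (p ⌊x⌋)).eval (Int.fract x)) x := by
    have := ((p ⌊x⌋).hasDerivAt (x - ⌊x⌋)).comp_sub_const x (⌊x⌋ : ℝ)
    simpa using this
  refine h1.hasDerivWithinAt.congr_of_eventuallyEq ?_ ?_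
  · filter_upwards [Icc_mem_nhdsGE (Int.lt_floor_add_one x)] with y hy
    have := h.eq_eval ⌊x⌋ (y - ⌊x⌋) ⟨by linarith [hy.1, Int.floor_le x], by linarith [hy.2]⟩
    simpa using this
  · exact h.eq_eval_floor x

theorem exists_abs_sub_le (h : IsPiecewiseCardinal r a p F) :
    ∃ M : ℝ, 0 ≤ M ∧ ∀ R : ℝ, 0 < R → ∀ x y : ℝ, x ≤ y → (∀ w ∈ Icc x y, R ≤ |w|) →
      |F y - F x| ≤ M / R ^ 3 * (y - x) := by
  obtain ⟨M, hM, hd⟩ := h.decay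
  refine ⟨M, hM, fun R hR x y hxy hw => ?_⟩
  refine norm_image_sub_le_of_norm_deriv_right_le_segment h.continuous.continuousOn
    (fun w _ => h.hasDerivWithinAt w) (fun w hw' => ?_) y ⟨hxy, le_rfl⟩
  refine (hd ⌊w⌋ 1 _ ⟨Int.fract_nonneg w, (Int.fract_lt_one w).le⟩).trans ?_
  gcongr
  exact (hw w (Ico_subset_Icc_self hw')).trans (abs_le_one_add_abs_floor w)

/-- `F` vanishes at `n`, and the segment from `n` to `n + θ` stays at distance at least `|n| / 2`
from the origin. The slope `O(|n|⁻³)` times the displacement `ε |n|` is summable in `n`. -/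
theorem exists_abs_int_add_le (h : IsPiecewiseCardinal r a p F) :
    ∃ K : ℝ, 0 ≤ K ∧ ∀ ε : ℝ, 0 ≤ ε → ε ≤ 1 / 2 → ∀ n : ℤ, n ≠ 0 → ∀ θ : ℝ, |θ| ≤ ε * |(n : ℝ)| →
      |F (n + θ)| ≤ ε * K * (1 / (n : ℝ) ^ 2) := by
  obtain ⟨M, hM, hd⟩ := h.exists_abs_sub_le
  refine ⟨8 * M, by positivity, fun ε hε hε' n hn θ hθ => ?_⟩
  have hn' : 0 < |(n : ℝ)| := by simpa using hn
  have hθ2 : |θ| ≤ |(n : ℝ)| / 2 := hθ.trans (by nlinarith)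
  have hF : F n = 0 := by simp [h.cardinal, hn]
  have hw : ∀ w : ℝ, |w - n| ≤ |(n : ℝ)| / 2 → |(n : ℝ)| / 2 ≤ |w| := fun w hw => by
    have := abs_sub_abs_le_abs_sub (n : ℝ) w
    rw [abs_sub_comm] at this
    linarith
  have hmain : |F (n + θ)| ≤ M / (|(n : ℝ)| / 2) ^ 3 * |θ| := by
    have hb := abs_le.1 hθ2
    rcases le_total 0 θ with h0 | h0
    · have := hd _ (half_pos hn') n (n + θ) (by linarith) fun w hw' => hw w
        (abs_le.2 ⟨by linarith [hw'.1, hw'.2], by linarith [hw'.1, hw'.2]⟩)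
      rw [hF, sub_zero, add_sub_cancel_left] at this
      rwa [abs_of_nonneg h0]
    · have := hd _ (half_pos hn') (n + θ) n (by linarith) fun w hw' => hw w
        (abs_le.2 ⟨by linarith [hw'.1, hw'.2], by linarith [hw'.1, hw'.2]⟩)
      rw [hF, zero_sub, abs_neg, sub_add_cancel_left] at this
      rwa [abs_of_nonpos h0]
  refine hmain.trans ?_
  calc M / (|(n : ℝ)| / 2) ^ 3 * |θ| ≤ M / (|(n : ℝ)| / 2) ^ 3 * (ε * |(n : ℝ)|) := by gcongr
    _ = ε * (8 * M) * (1 / |(n : ℝ)| ^ 2) := by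
      field_simp
      ring
    _ = _ := by rw [sq_abs]

theorem exists_sum_abs_gram_le (h : IsPiecewiseCardinal r a p F) :
    ∃ K : ℝ, 0 ≤ K ∧ ∀ ε : ℝ, 0 ≤ ε → ε ≤ 1 / 2 → ∀ α : ℤ → ℝ,
      (∀ i j : ℤ, |α i - α j - (i - j)| ≤ ε * |(i : ℝ) - j|) → ∀ (I : Finset ℤ) (i : ℤ),
        ∑ j ∈ I, |F (α i - α j)| ≤ 1 + K * ε := by
  obtain ⟨K, hK, hd⟩ := h.exists_abs_int_add_le
  have hs : Summable fun m : ℤ => 1 / (m : ℝ) ^ 2 := Real.summable_one_div_int_pow.2 one_lt_two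
  refine ⟨K * ∑' m : ℤ, 1 / (m : ℝ) ^ 2, mul_nonneg hK (tsum_nonneg fun _ => by positivity),
    fun ε hε hε' α hα I i => ?_⟩
  have hF0 : F 0 = 1 := by simpa using h.cardinal 0
  have h1 : ∀ j : ℤ, |F (α i - α j)| ≤
      (if j = i then 1 else 0) + ε * K * (1 / ((i - j : ℤ) : ℝ) ^ 2) := by
    intro j
    split_ifs with hj
    · subst hj
      simp [hF0]
    · have := hd ε hε hε' (i - j) (sub_ne_zero.2 (Ne.symm hj)) (α i - α j - (i - j))
        (by simpa using hα i j)
      rw [zero_add]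
      refine le_trans (le_of_eq ?_) this
      congr 2
      push_cast
      ring
  have hs' : Summable fun j : ℤ => 1 / ((i - j : ℤ) : ℝ) ^ 2 :=
    ((Equiv.subLeft i).summable_iff (f := fun m : ℤ => 1 / (m : ℝ) ^ 2)).2 hs
  have ht : ∑' j : ℤ, 1 / ((i - j : ℤ) : ℝ) ^ 2 = ∑' m : ℤ, 1 / (m : ℝ) ^ 2 :=
    (Equiv.subLeft i).tsum_eq fun m : ℤ => 1 / (m : ℝ) ^ 2
  calc ∑ j ∈ I, |F (α i - α j)|
      ≤ ∑ j ∈ I, ((if j = i then 1 else 0) + ε * K * (1 / ((i - j : ℤ) : ℝ) ^ 2)) :=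
        Finset.sum_le_sum fun j _ => h1 j
    _ ≤ 1 + ε * K * ∑' m : ℤ, 1 / (m : ℝ) ^ 2 := by
        rw [Finset.sum_add_distrib, ← Finset.mul_sum]
        gcongr
        · rw [Finset.sum_ite_eq']
          split_ifs <;> norm_num
        · rw [← ht]
          exact hs'.sum_le_tsum _ fun _ _ => by positivity
    _ = _ := by ring

/-- The interpolation operator at points `α i` whose spacing is within a factor `1 ± ε` of that of
the grid has squared `ℓ²` norm `1 + O(ε)`. -/
theorem exists_sum_sq_le (h : IsPiecewiseCardinal r a p F) (ha : ∀ s, 0 ≤ a s) (har : 0 < a r) :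
    ∃ K : ℝ, 0 ≤ K ∧ ∀ ε : ℝ, 0 ≤ ε → ε ≤ 1 / 2 → ∀ α : ℤ → ℝ,
      (∀ i j : ℤ, |α i - α j - (i - j)| ≤ ε * |(i : ℝ) - j|) →
        ∀ (I J : Finset ℤ) (c : ℤ → ℝ),
          ∑ i ∈ I, (∑ j ∈ J, F (α i - j) * c j) ^ 2 ≤ (1 + K * ε) * ∑ j ∈ J, c j ^ 2 := by
  obtain ⟨K, hK, hd⟩ := h.exists_sum_abs_gram_le
  refine ⟨K, hK, fun ε hε hε' α hα I J c => ?_⟩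
  set L := 1 + K * ε with hL
  have hL0 : 0 < L := by positivity
  set d : ℤ → ℝ := fun i => ∑ j ∈ J, F (α i - j) * c j with hdd
  -- Schur's test: `2 |d_i d_j| ≤ d_i² + d_j²`, and by evenness of `F` row and column sums agree.
  have hG : ∑ i ∈ I, ∑ j ∈ I, d i * d j * F (α i - α j) ≤ L * ∑ i ∈ I, d i ^ 2 := by
    have h1 : ∀ i j, d i * d j * F (α i - α j) ≤
        d i ^ 2 / 2 * |F (α i - α j)| + d j ^ 2 / 2 * |F (α i - α j)| := by
      intro i j
      have h2 : d i * d j * F (α i - α j) ≤ |d i * d j| * |F (α i - α j)| := by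
        rw [← abs_mul]
        exact le_abs_self _
      have h3 : |d i * d j| ≤ d i ^ 2 / 2 + d j ^ 2 / 2 := by
        rw [abs_mul, ← sq_abs (d i), ← sq_abs (d j)]
        nlinarith [sq_nonneg (|d i| - |d j|)]
      nlinarith [abs_nonneg (F (α i - α j))]
    have hsym : ∀ i j, |F (α i - α j)| = |F (α j - α i)| := fun i j => by
      rw [← h.map_neg ha har, neg_sub]
    have h4 : ∑ i ∈ I, ∑ j ∈ I, d i ^ 2 / 2 * |F (α i - α j)| ≤ L * ∑ i ∈ I, d i ^ 2 / 2 := by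
      rw [Finset.mul_sum]
      refine Finset.sum_le_sum fun i _ => ?_
      rw [← Finset.mul_sum, mul_comm]
      exact mul_le_mul_of_nonneg_right (hd ε hε hε' α hα I i) (by positivity)
    have h5 : ∑ i ∈ I, ∑ j ∈ I, d j ^ 2 / 2 * |F (α i - α j)| ≤ L * ∑ i ∈ I, d i ^ 2 / 2 := by
      rw [Finset.sum_comm]
      simp_rw [fun i j => hsym j i]
      exact h4
    calc _ ≤ ∑ i ∈ I, ∑ j ∈ I, (d i ^ 2 / 2 * |F (α i - α j)| + d j ^ 2 / 2 * |F (α i - α j)|) :=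
          Finset.sum_le_sum fun i _ => Finset.sum_le_sum fun j _ => h1 i j
      _ = ∑ i ∈ I, ∑ j ∈ I, d i ^ 2 / 2 * |F (α i - α j)| +
          ∑ i ∈ I, ∑ j ∈ I, d j ^ 2 / 2 * |F (α i - α j)| := by
          simp only [Finset.sum_add_distrib]
      _ ≤ L * ∑ i ∈ I, d i ^ 2 / 2 + L * ∑ i ∈ I, d i ^ 2 / 2 := add_le_add h4 h5
      _ = _ := by
          rw [← Finset.sum_div]
          ring
  -- The test vector `(L c, -d)` on nodes and points gives `0 ≤ L² |c|² - 2 L |d|² + dᵀ G d`. With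
  -- `dᵀ G d ≤ L |d|²` this is `L |d|² ≤ L² |c|²`.
  have hPD := h.sum_mul_nonneg ha har (J.disjSum I)
    (Sum.elim (fun j : ℤ => (j : ℝ)) α) (Sum.elim (fun j => L * c j) fun i => -d i)
  simp only [Finset.sum_disjSum, Sum.elim_inl, Sum.elim_inr, Finset.sum_add_distrib] at hPD
  have e1 : ∑ i ∈ J, ∑ j ∈ J, L * c i * (L * c j) * F ((i : ℝ) - j) =
      L ^ 2 * ∑ j ∈ J, c j ^ 2 := by
    rw [Finset.mul_sum]
    refine Finset.sum_congr rfl fun i hi => ?_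
    rw [Finset.sum_eq_single i]
    · have : F 0 = 1 := by simpa using h.cardinal 0
      rw [sub_self, this]
      ring
    · intro j _ hj
      have := h.cardinal (i - j)
      rw [if_neg (sub_ne_zero.2 hj.symm)] at this
      push_cast at this
      rw [this, mul_zero]
    · exact fun h => absurd hi h
  have e2 : ∑ i ∈ I, ∑ j ∈ J, -d i * (L * c j) * F (α i - j) = -L * ∑ i ∈ I, d i ^ 2 := by
    rw [Finset.mul_sum]
    refine Finset.sum_congr rfl fun i _ => ?_
    have : d i ^ 2 = d i * ∑ j ∈ J, F (α i - j) * c j := by rw [sq]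
    rw [this, Finset.mul_sum, Finset.mul_sum]
    refine Finset.sum_congr rfl fun j _ => ?_
    ring
  have e3 : ∑ i ∈ J, ∑ j ∈ I, L * c i * -d j * F ((i : ℝ) - α j) =
      -L * ∑ i ∈ I, d i ^ 2 := by
    rw [← e2, Finset.sum_comm]
    refine Finset.sum_congr rfl fun i _ => Finset.sum_congr rfl fun j _ => ?_
    rw [← h.map_neg ha har, neg_sub]
    ring
  have e4 : ∑ i ∈ I, ∑ j ∈ I, -d i * -d j * F (α i - α j) =
      ∑ i ∈ I, ∑ j ∈ I, d i * d j * F (α i - α j) := by simp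
  rw [e1, e2, e3, e4] at hPD
  have h6 : L * ∑ i ∈ I, d i ^ 2 ≤ L * (L * ∑ j ∈ J, c j ^ 2) := by nlinarith
  exact le_of_mul_le_mul_left h6 hL0

end IsPiecewiseCardinal

/-! ### From finite sections to a bounded operator on `ℓ²`. -/

theorem matrixNormLE_two {B : Matrix ℤ ℤ ℝ} {M : ℝ} (hM : 0 ≤ M)
    (h : ∀ (I J : Finset ℤ) (c : ℤ → ℝ),
      ∑ i ∈ I, (∑ j ∈ J, B i j * c j) ^ 2 ≤ M ^ 2 * ∑ j ∈ J, c j ^ 2) :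
    MatrixNormLE 2 B M := by
  have hrow : ∀ i, Summable fun j => B i j ^ 2 := by
    intro i
    refine summable_of_sum_le (c := M ^ 2) (fun j => sq_nonneg _) fun J => ?_
    -- Testing row `i` against itself gives `(∑ b²)² ≤ M² ∑ b²`, so every row is square summable.
    have h1 := h {i} J (B i)
    rw [Finset.sum_singleton] at h1
    simp_rw [← sq] at h1
    by_contra! h2
    have h3 : 0 < ∑ j ∈ J, B i j ^ 2 := (sq_nonneg M).trans_lt h2
    nlinarith
  have hsq : ∀ c : lp (fun _ : ℤ => ℝ) 2, HasSum (fun j => c j ^ 2) (‖c‖ ^ 2) := by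
    intro c
    have := lp.hasSum_norm (p := 2) (by norm_num) c
    simpa using this
  have hsum : ∀ (c : lp (fun _ : ℤ => ℝ) 2) (i : ℤ), Summable fun j => B i j * c j := by
    intro c i
    refine Summable.of_norm_bounded ((hrow i).add (hsq c).summable) fun j => ?_
    rw [Real.norm_eq_abs, abs_mul, ← sq_abs (B i j), ← sq_abs (c j)]
    nlinarith [sq_nonneg (|B i j| - |c j|), sq_nonneg (|B i j|), sq_nonneg |c j|]
  have hbound : ∀ (c : lp (fun _ : ℤ => ℝ) 2) (I : Finset ℤ),
      ∑ i ∈ I, ‖∑' j, B i j * c j‖ ^ (2 : ℝ≥0∞).toReal ≤ (M * ‖c‖) ^ (2 : ℝ≥0∞).toReal := by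
    intro c I
    have h1 : Tendsto (fun J : Finset ℤ => ∑ i ∈ I, (∑ j ∈ J, B i j * c j) ^ 2) atTop
        (𝓝 (∑ i ∈ I, (∑' j, B i j * c j) ^ 2)) :=
      tendsto_finsetSum _ fun i _ => (hsum c i).hasSum.pow 2
    have h2 := le_of_tendsto' h1 fun J => (h I J c).trans
      (mul_le_mul_of_nonneg_left (sum_le_hasSum J (fun _ _ => sq_nonneg _) (hsq c))
        (sq_nonneg M))
    simpa [mul_pow] using h2
  let T : lp (fun _ : ℤ => ℝ) 2 →ₗ[ℝ] lp (fun _ : ℤ => ℝ) 2 :=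
    { toFun := fun c => ⟨fun i => ∑' j, B i j * c j, memℓp_gen' (hbound c)⟩
      map_add' := fun c d => by
        ext i
        simp only [lp.coeFn_add, Pi.add_apply, mul_add]
        exact (hsum c i).tsum_add (hsum d i)
      map_smul' := fun t c => by
        ext i
        simp only [lp.coeFn_smul, Pi.smul_apply, smul_eq_mul, RingHom.id_apply]
        rw [← tsum_mul_left]
        exact tsum_congr fun j => by ring }
  refine ⟨T.mkContinuous M fun c => ?_, fun c i => (hsum c i).hasSum,
    LinearMap.mkContinuous_norm_le _ hM _⟩
  exact lp.norm_le_of_forall_sum_le (by norm_num) (by positivity) (hbound c)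

/-! ### Decay of monotone sequences, and coercivity of quadratic forms in polynomial coefficients.
-/

/-- A bounded monotone sequence has increments tending to `0`, so here `β` tends to `0` from below.
The hypothesis then reads `-β (i + N) ≤ θ (-β i)` with `θ = C / (1 + C) < 1`, and geometric decay
beats any power. The exponent `6` becomes `3` once a square root is taken. -/
theorem exists_le_div_pow_of_abs_le {β : ℕ → ℝ} (hmono : Monotone β) {B C : ℝ} {N : ℕ}
    (hN : 0 < N) (hB : ∀ i, β i ≤ B) (hC : 0 ≤ C)
    (h : ∀ i, |β i| ≤ C * (β (i + N) - β i)) :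
    ∃ M : ℝ, 0 ≤ M ∧ ∀ i : ℕ, β (i + N) - β i ≤ M / (1 + (i : ℝ)) ^ 6 := by
  have hbdd : BddAbove (range β) := ⟨B, by rintro _ ⟨i, rfl⟩; exact hB i⟩
  have hlim := tendsto_atTop_ciSup hmono hbdd
  have hlim' : Tendsto (fun i => C * (β (i + N) - β i)) atTop (𝓝 0) := by
    have := (((tendsto_add_atTop_iff_nat N).2 hlim).sub hlim).const_mul C
    simpa using this
  have hβ0 : Tendsto β atTop (𝓝 0) := squeeze_zero_norm h hlim'
  have hneg : ∀ i, β i ≤ 0 := fun i => hmono.ge_of_tendsto hβ0 i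
  set θ := C / (1 + C) with hθ
  have hθ0 : 0 ≤ θ := by positivity
  have hθ1 : θ < 1 := by
    rw [hθ, div_lt_one (by positivity)]
    linarith
  have hstep : ∀ i, -β (i + N) ≤ θ * -β i := by
    intro i
    have h1 := h i
    rw [abs_of_nonpos (hneg i)] at h1
    have h2 := hmono (Nat.le_add_right i N)
    rw [hθ, div_mul_eq_mul_div, le_div_iff₀ (by positivity)]
    nlinarith
  have hgeom : ∀ k : ℕ, -β (N * k) ≤ θ ^ k * -β 0 := by
    intro k
    induction k with
    | zero => simp
    | succ k ih =>
      rw [Nat.mul_succ, pow_succ']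
      calc _ ≤ θ * -β (N * k) := hstep _
        _ ≤ θ * (θ ^ k * -β 0) := by gcongr
        _ = _ := by ring
  obtain ⟨M₁, hM₁⟩ := (tendsto_pow_const_mul_const_pow_of_abs_lt_one 6
    (by rwa [abs_of_nonneg hθ0])).bddAbove_range
  have hM₁' : ∀ k : ℕ, (k : ℝ) ^ 6 * θ ^ k ≤ M₁ := fun k => hM₁ ⟨k, rfl⟩
  have hM₁0 : 0 ≤ M₁ := by simpa using hM₁' 0
  have hpoly : ∀ k : ℕ, (1 + (k : ℝ)) ^ 6 * θ ^ k ≤ 64 * (1 + M₁) := by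
    intro k
    have h1 : (1 + (k : ℝ)) ^ 6 ≤ 64 * (1 + (k : ℝ) ^ 6) := by
      rcases Nat.eq_zero_or_pos k with rfl | hk
      · norm_num
      · have hk' : (1 : ℝ) ≤ k := by exact_mod_cast hk
        calc (1 + (k : ℝ)) ^ 6 ≤ (k + k) ^ 6 := by gcongr
          _ = 64 * (k : ℝ) ^ 6 := by ring
          _ ≤ _ := by linarith
    have h2 := pow_le_one₀ (n := k) hθ0 hθ1.le
    have h3 := hM₁' k
    calc _ ≤ 64 * (1 + (k : ℝ) ^ 6) * θ ^ k := by gcongr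
      _ ≤ _ := by linarith
  have hb0 : 0 ≤ -β 0 := by linarith [hneg 0]
  refine ⟨64 * (1 + M₁) * N ^ 6 * -β 0, by positivity, fun i => ?_⟩
  have h1 : β (i + N) - β i ≤ -β (N * (i / N)) := by
    linarith [hneg (i + N), hmono (Nat.mul_div_le i N)]
  have h2 : 1 + (i : ℝ) ≤ N * (1 + ((i / N : ℕ) : ℝ)) := by
    have := Nat.lt_mul_div_succ i hN
    have h3 : 1 + i ≤ N * (1 + i / N) := by
      rw [add_comm 1 (i / N)]
      omega
    exact_mod_cast h3
  rw [le_div_iff₀ (by positivity)]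
  calc (β (i + N) - β i) * (1 + (i : ℝ)) ^ 6
      ≤ (θ ^ (i / N) * -β 0) * (N * (1 + ((i / N : ℕ) : ℝ))) ^ 6 := by
        gcongr
        exact h1.trans (hgeom _)
    _ = ((1 + ((i / N : ℕ) : ℝ)) ^ 6 * θ ^ (i / N)) * (N ^ 6 * -β 0) := by ring
    _ ≤ (64 * (1 + M₁)) * (N ^ 6 * -β 0) :=
        mul_le_mul_of_nonneg_right (hpoly _) (by positivity)
    _ = _ := by ring

/-- A continuous function homogeneous of degree two and positive on a subspace of a
finite-dimensional space is coercive there. -/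
theorem exists_mul_norm_sq_le {E : Type*} [NormedAddCommGroup E] [NormedSpace ℝ E]
    [FiniteDimensional ℝ E] (S : Submodule ℝ E) {Q : E → ℝ} (hQ : Continuous Q)
    (hom : ∀ (t : ℝ) x, Q (t • x) = t ^ 2 * Q x) (hpos : ∀ x ∈ S, x ≠ 0 → 0 < Q x) :
    ∃ κ : ℝ, 0 < κ ∧ ∀ x ∈ S, κ * ‖x‖ ^ 2 ≤ Q x := by
  have : ProperSpace E := FiniteDimensional.proper ℝ E
  have hcomp : IsCompact (Metric.sphere (0 : E) 1 ∩ S) :=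
    (isCompact_sphere 0 1).inter_right S.closed_of_finiteDimensional
  have hunit : ∀ x ∈ S, x ≠ 0 → ‖x‖⁻¹ • x ∈ Metric.sphere (0 : E) 1 ∩ S := by
    intro x hx hx0
    refine ⟨?_, S.smul_mem _ hx⟩
    simp [norm_smul, inv_mul_cancel₀ (norm_ne_zero_iff.2 hx0)]
  have hQ0 : Q 0 = 0 := by simpa using hom 0 0
  rcases (Metric.sphere (0 : E) 1 ∩ (S : Set E)).eq_empty_or_nonempty with he | hne
  · refine ⟨1, one_pos, fun x hx => ?_⟩
    by_cases hx0 : x = 0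
    · simp [hx0, hQ0]
    · have := hunit x hx hx0
      rw [he] at this
      exact absurd this (notMem_empty _)
  · obtain ⟨y, hy, hmin⟩ := hcomp.exists_isMinOn hne hQ.continuousOn
    have hy0 : y ≠ 0 := by
      rintro rfl
      simpa using hy.1
    refine ⟨Q y, hpos y hy.2 hy0, fun x hx => ?_⟩
    by_cases hx0 : x = 0
    · simp [hx0, hQ0]
    · have h1 : Q y ≤ Q (‖x‖⁻¹ • x) := hmin (hunit x hx hx0)
      rw [hom, inv_pow, ← div_eq_inv_mul, le_div_iff₀ (by positivity)] at h1
      exact h1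

/-- The polynomial with the given coefficients. -/
noncomputable def polyOf (n : ℕ) : (Fin n → ℝ) →ₗ[ℝ] ℝ[X] :=
  ∑ i : Fin n, (monomial (i : ℕ)).comp (LinearMap.proj i)

theorem polyOf_apply (n : ℕ) (x : Fin n → ℝ) :
    polyOf n x = ∑ i : Fin n, C (x i) * X ^ (i : ℕ) := by
  simp [polyOf, C_mul_X_pow_eq_monomial]

theorem polyOf_coeff {n : ℕ} {p : ℝ[X]} (hp : p.natDegree < n) :
    polyOf n (fun i => p.coeff i) = p := by
  rw [polyOf_apply, Fin.sum_univ_eq_sum_range fun i => C (p.coeff i) * X ^ i]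
  exact (p.as_sum_range_C_mul_X_pow' hp).symm

theorem coeff_polyOf {n : ℕ} (x : Fin n → ℝ) (i : Fin n) : (polyOf n x).coeff i = x i := by
  rw [polyOf_apply, finsetSum_coeff, Finset.sum_eq_single i]
  · simp
  · intro j _ hj
    rw [coeff_C_mul_X_pow, if_neg]
    exact fun h => hj (Fin.ext h.symm)
  · simp

theorem degree_polyOf_lt (n : ℕ) (x : Fin n → ℝ) : (polyOf n x).degree < n := by
  rw [polyOf_apply]
  exact degree_sum_fin_lt x

theorem eq_zero_of_polyOf_eq_zero {n : ℕ} {x : Fin n → ℝ} (h : polyOf n x = 0) : x = 0 := by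
  funext i
  rw [← coeff_polyOf x i, h]
  simp

theorem continuous_eval_polyOf (n k : ℕ) (t : ℝ) :
    Continuous fun x : Fin n → ℝ => (derivative^[k] (polyOf n x)).eval t := by
  simp only [polyOf_apply, iterate_derivative_sum, iterate_derivative_C_mul, eval_finsetSum,
    eval_mul, eval_C]
  fun_prop

theorem abs_eval_iterate_derivative_polyOf_le (n : ℕ) (x : Fin n → ℝ) (k : ℕ) {t : ℝ}
    (ht : t ∈ Icc (0 : ℝ) 1) :
    |(derivative^[k] (polyOf n x)).eval t| ≤ (n * n.factorial : ℝ) * ‖x‖ := by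
  simp only [polyOf_apply, iterate_derivative_sum, iterate_derivative_C_mul, eval_finsetSum,
    eval_mul, eval_C, iterate_derivative_X_pow_eq_natCast_mul, eval_natCast, eval_pow, eval_X]
  have h1 : ∀ i : Fin n, |x i * ((((i : ℕ).descFactorial k : ℕ) : ℝ) * t ^ ((i : ℕ) - k))| ≤
      n.factorial * ‖x‖ := by
    intro i
    have h2 : |x i| ≤ ‖x‖ := norm_le_pi_norm x i
    have h3 : (((i : ℕ).descFactorial k : ℕ) : ℝ) ≤ n.factorial := by
      have h4 : (n.descFactorial k) ≤ n.factorial := by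
        rcases le_or_gt k n with hk | hk
        · exact Nat.le_of_dvd n.factorial_pos ⟨_, (by rw [mul_comm, Nat.factorial_mul_descFactorial hk])⟩
        · simp [Nat.descFactorial_of_lt hk]
      exact_mod_cast (Nat.descFactorial_le k i.2.le).trans h4
    have h4 : t ^ ((i : ℕ) - k) ≤ 1 := pow_le_one₀ ht.1 ht.2
    have h5 : 0 ≤ t ^ ((i : ℕ) - k) := pow_nonneg ht.1 _
    rw [abs_mul, abs_mul, Nat.abs_cast, abs_of_nonneg h5, mul_comm]
    calc _ ≤ (n.factorial * 1 : ℝ) * ‖x‖ := by gcongr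
      _ = _ := by ring
  refine (Finset.abs_sum_le_sum_abs _ _).trans ((Finset.sum_le_sum fun i _ => h1 i).trans ?_)
  simp [mul_assoc]

/-- The values at the `n` points `j / n` determine a polynomial of degree less than `n`, so the sum
of their squares is a positive definite form. -/
theorem exists_norm_sq_le_of_abs_eval_le (n : ℕ) (B : ℝ) : ∃ D : ℝ, 0 ≤ D ∧ ∀ x : Fin n → ℝ,
    (∀ t ∈ Icc (0 : ℝ) 1, |(polyOf n x).eval t| ≤ B) → ‖x‖ ^ 2 ≤ D := by
  have hcont : Continuous fun x : Fin n → ℝ =>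
      ∑ j : Fin n, (polyOf n x).eval ((j : ℝ) / n) ^ 2 :=
    continuous_finsetSum _ fun j _ => (continuous_eval_polyOf n 0 _).pow 2
  obtain ⟨κ, hκ, hd⟩ := exists_mul_norm_sq_le ⊤ hcont
    (fun t x => by simp [Finset.mul_sum, mul_pow]) (fun x _ hx => by
      by_contra! hle
      refine hx (eq_zero_of_polyOf_eq_zero ?_)
      have h0 := (Finset.sum_eq_zero_iff_of_nonneg fun j _ => sq_nonneg _).1
        (le_antisymm hle (Finset.sum_nonneg fun j _ => sq_nonneg _))
      refine eq_zero_of_degree_lt_of_eval_index_eq_zero (s := Finset.univ)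
        (v := fun j : Fin n => (j : ℝ) / n) (fun i _ j _ hij => ?_)
        (by simpa using degree_polyOf_lt n x) fun j hj => pow_eq_zero_iff two_ne_zero |>.1 (h0 j hj)
      have hn : (n : ℝ) ≠ 0 := by
        have := i.pos
        positivity
      simp only [div_left_inj' hn, Nat.cast_inj] at hij
      exact Fin.ext hij)
  refine ⟨n * B ^ 2 / κ, by positivity, fun x hx => ?_⟩
  rw [le_div_iff₀ hκ, mul_comm]
  refine (hd x trivial).trans ?_
  calc ∑ j : Fin n, (polyOf n x).eval ((j : ℝ) / n) ^ 2 ≤ ∑ j : Fin n, B ^ 2 := by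
        refine Finset.sum_le_sum fun j _ => sq_le_sq' ?_ ?_
        all_goals
          have hj : (j : ℝ) / n ∈ Icc (0 : ℝ) 1 :=
            ⟨by positivity, div_le_one_of_le₀ (by exact_mod_cast j.2.le) (by positivity)⟩
          have := abs_le.1 (hx _ hj)
          linarith
    _ = _ := by simp

/-! ### Energy and decay of null chains. -/

/-- The boundary form of the integration by parts of `∫ (p^{(r+1)})²`, for a polynomial `p` of
degree at most `2r + 1`. -/
noncomputable def boundaryForm (r : ℕ) (p : ℝ[X]) (t : ℝ) : ℝ :=
  ∑ l ∈ Finset.range (r + 1),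
    (-1) ^ l * (derivative^[r + 1 + l] p).eval t * (derivative^[r - l] p).eval t

/-- The derivative telescopes; the far end contains the derivative of order `2r + 2`, which vanishes
by the degree bound. -/
theorem hasDerivAt_boundaryForm {r : ℕ} {p : ℝ[X]} (hp : p.natDegree ≤ 2 * r + 1) (t : ℝ) :
    HasDerivAt (boundaryForm r p) ((derivative^[r + 1] p).eval t ^ 2) t := by
  let g : ℕ → ℝ := fun l =>
    (-1) ^ l * (derivative^[r + 1 + l] p).eval t * (derivative^[r + 1 - l] p).eval t
  have h1 : HasDerivAt (boundaryForm r p) (∑ l ∈ Finset.range (r + 1), (g l - g (l + 1))) t := by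
    unfold boundaryForm
    refine HasDerivAt.fun_sum fun l hl => ?_
    have hl' : r + 1 - l = (r - l) + 1 := by
      have := Finset.mem_range.1 hl
      omega
    have h2 := (((derivative^[r + 1 + l] p).hasDerivAt t).const_mul ((-1) ^ l)).mul
      ((derivative^[r - l] p).hasDerivAt t)
    refine h2.congr_deriv ?_
    simp only [g, ← Function.iterate_succ_apply', hl', Nat.succ_eq_add_one, Nat.add_sub_add_right,
      ← add_assoc, pow_succ]
    ring
  have hz : derivative^[r + 1 + (r + 1)] p = 0 := iterate_derivative_eq_zero (by omega)
  have h3 : g (r + 1) = 0 := by simp [g, hz]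
  rw [Finset.sum_range_sub', h3] at h1
  refine h1.congr_deriv ?_
  simp [g, sq]

theorem boundaryForm_mono {r : ℕ} {p : ℝ[X]} (hp : p.natDegree ≤ 2 * r + 1) :
    Monotone (boundaryForm r p) :=
  monotone_of_hasDerivAt_nonneg (fun t => hasDerivAt_boundaryForm hp t) fun _ => sq_nonneg _

theorem iterate_derivative_eq_zero_of_boundaryForm {r : ℕ} {p : ℝ[X]}
    (hp : p.natDegree ≤ 2 * r + 1) (h : boundaryForm r p 1 = boundaryForm r p 0) :
    derivative^[r + 1] p = 0 := by
  refine eq_zero_of_infinite_isRoot _ ((Ioo_infinite (zero_lt_one' ℝ)).mono fun t ht => ?_)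
  have hconst : boundaryForm r p =ᶠ[𝓝 t] fun _ => boundaryForm r p 0 := by
    filter_upwards [Ioo_mem_nhds ht.1 ht.2] with s hs
    exact le_antisymm ((boundaryForm_mono hp hs.2.le).trans h.le) (boundaryForm_mono hp hs.1.le)
  have h1 := (hasDerivAt_boundaryForm hp t).congr_of_eventuallyEq hconst.symm
  exact pow_eq_zero_iff two_ne_zero |>.1 (h1.unique (hasDerivAt_const t _))

theorem coeff_eq_zero_of_eval_iterate_derivative {p : ℝ[X]} {k : ℕ}
    (h : (derivative^[k] p).eval 0 = 0) : p.coeff k = 0 := by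
  rw [← coeff_zero_eq_eval_zero, coeff_iterate_derivative, zero_add, Nat.descFactorial_self,
    nsmul_eq_mul] at h
  exact (mul_eq_zero.1 h).resolve_left (by positivity)

theorem coeff_eq_zero_of_iterate_derivative_eq_zero {p : ℝ[X]} {n k : ℕ}
    (h : derivative^[n] p = 0) (hk : n ≤ k) : p.coeff k = 0 := by
  refine coeff_eq_zero_of_eval_iterate_derivative ?_
  obtain ⟨j, rfl⟩ := Nat.exists_eq_add_of_le hk
  rw [add_comm, Function.iterate_add_apply, h, iterate_derivative_zero, eval_zero]

/-- A chain of polynomial pieces of degree at most `2r + 1` on successive unit cells, in local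
coordinates, joining with `2r` continuous derivatives and vanishing at the nodes. -/
structure IsNullChain (r n : ℕ) (q : ℕ → ℝ[X]) : Prop where
  natDegree_le : ∀ i < n, (q i).natDegree ≤ 2 * r + 1
  eval_zero : ∀ i < n, (q i).eval 0 = 0
  join : ∀ i, i + 1 < n → ∀ k ≤ 2 * r,
    (derivative^[k] (q i)).eval 1 = (derivative^[k] (q (i + 1))).eval 0

/-- Pieces of degree at most `r` that agree to order `r` at the joints form one polynomial of degree
at most `r`, and it has the `r + 1` zeros `0, …, r`. This fixes the length of the chains. -/
theorem IsNullChain.eq_zero {r : ℕ} {q : ℕ → ℝ[X]} (h : IsNullChain r (r + 1) q)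
    (hd : ∀ i < r + 1, derivative^[r + 1] (q i) = 0) : ∀ i < r + 1, q i = 0 := by
  have hcomp : ∀ i < r + 1, q i = (q 0).comp (X + C (i : ℝ)) := by
    intro i
    induction i with
    | zero => simp
    | succ i ih =>
      intro hi
      have h1 : q (i + 1) = (q i).comp (X + 1) := by
        rw [← sub_eq_zero]
        ext k
        rw [coeff_zero]
        have hsub : ∀ k, derivative^[k] (q (i + 1) - (q i).comp (X + 1)) =
            derivative^[k] (q (i + 1)) - (derivative^[k] (q i)).comp (X + 1) := fun k => by
          rw [iterate_derivative_sub, iterate_derivative_comp_X_add_one]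
        rcases le_or_gt k r with hk | hk
        · refine coeff_eq_zero_of_eval_iterate_derivative ?_
          rw [hsub]
          simp [h.join i hi k (by omega)]
        · refine coeff_eq_zero_of_iterate_derivative_eq_zero (n := r + 1) ?_ hk
          rw [hsub, hd _ hi, hd i (by omega)]
          simp
      rw [h1, ih (by omega), comp_assoc]
      congr 1
      simp
      ring
  have h0 : q 0 = 0 := by
    have hdeg : (q 0).natDegree ≤ r := natDegree_le_iff_coeff_eq_zero.2 fun N hN =>
      coeff_eq_zero_of_iterate_derivative_eq_zero (hd 0 (by omega)) hN
    refine eq_zero_of_degree_lt_of_eval_index_eq_zero (s := Finset.range (r + 1))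
      (v := fun i : ℕ => (i : ℝ)) (fun i _ j _ hij => Nat.cast_injective hij) ?_ fun i hi => ?_
    · refine degree_le_natDegree.trans_lt ?_
      rw [Finset.card_range]
      exact_mod_cast Nat.lt_succ_of_le hdeg
    · have := h.eval_zero i (Finset.mem_range.1 hi)
      rw [hcomp i (Finset.mem_range.1 hi)] at this
      simpa using this
  intro i hi
  rw [hcomp i hi, h0, zero_comp]

theorem continuous_boundaryForm_polyOf (r n : ℕ) (t : ℝ) :
    Continuous fun x : Fin n → ℝ => boundaryForm r (polyOf n x) t := by
  unfold boundaryForm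
  exact continuous_finsetSum _ fun l _ => (((continuous_eval_polyOf n _ t).const_mul _).mul
    (continuous_eval_polyOf n _ t))

theorem boundaryForm_smul (r : ℕ) (c : ℝ) (p : ℝ[X]) (t : ℝ) :
    boundaryForm r (c • p) t = c ^ 2 * boundaryForm r p t := by
  simp only [boundaryForm, iterate_derivative_smul, eval_smul, smul_eq_mul, Finset.mul_sum]
  exact Finset.sum_congr rfl fun l _ => by ring

theorem boundaryForm_zero_le_one {r : ℕ} {p : ℝ[X]} (hp : p.natDegree ≤ 2 * r + 1) :
    0 ≤ boundaryForm r p 1 - boundaryForm r p 0 :=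
  sub_nonneg.2 (boundaryForm_mono hp zero_le_one)

theorem natDegree_polyOf_le (r : ℕ) (x : Fin (2 * r + 2) → ℝ) :
    (polyOf (2 * r + 2) x).natDegree ≤ 2 * r + 1 := by
  rw [natDegree_le_iff_degree_le]
  exact Order.le_of_lt_succ (degree_polyOf_lt (2 * r + 2) x)

/-- The energy of a null chain of `r + 1` pieces controls the coefficients of its first piece. -/
theorem exists_mul_norm_sq_le_energy (r : ℕ) : ∃ κ : ℝ, 0 < κ ∧ ∀ q : ℕ → ℝ[X],
    IsNullChain r (r + 1) q → κ * ‖fun i : Fin (2 * r + 2) => (q 0).coeff i‖ ^ 2 ≤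
      ∑ i ∈ Finset.range (r + 1), (boundaryForm r (q i) 1 - boundaryForm r (q i) 0) := by
  let P : (Fin (2 * r + 2) → ℝ) →ₗ[ℝ] ℝ[X] := polyOf (2 * r + 2)
  let S : Submodule ℝ (Fin (r + 1) → Fin (2 * r + 2) → ℝ) :=
    { carrier := {x | (∀ i, (P (x i)).eval 0 = 0) ∧ ∀ i j : Fin (r + 1), (j : ℕ) = i + 1 →
        ∀ k ≤ 2 * r, (derivative^[k] (P (x i))).eval 1 = (derivative^[k] (P (x j))).eval 0}
      zero_mem' := by simp
      add_mem' := by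
        rintro x y ⟨hx, hx'⟩ ⟨hy, hy'⟩
        refine ⟨fun i => by simp [hx i, hy i], fun i j hij k hk => ?_⟩
        simp [hx' i j hij k hk, hy' i j hij k hk]
      smul_mem' := by
        rintro c x ⟨hx, hx'⟩
        refine ⟨fun i => by simp [hx i], fun i j hij k hk => ?_⟩
        simp [iterate_derivative_smul, hx' i j hij k hk] }
  let Q : (Fin (r + 1) → Fin (2 * r + 2) → ℝ) → ℝ := fun x => ∑ i, (boundaryForm r (P (x i)) 1 - boundaryForm r (P (x i)) 0)
  have hQ : Continuous Q := continuous_finsetSum _ fun i _ =>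
    ((continuous_boundaryForm_polyOf r _ 1).comp (continuous_apply i)).sub
      ((continuous_boundaryForm_polyOf r _ 0).comp (continuous_apply i))
  have hom : ∀ (t : ℝ) x, Q (t • x) = t ^ 2 * Q x := by
    intro t x
    simp only [Q, Pi.smul_apply, map_smul, boundaryForm_smul, Finset.mul_sum, mul_sub]
  have hdeg : ∀ x, (P x).natDegree ≤ 2 * r + 1 := natDegree_polyOf_le r
  -- Zero total energy kills the derivative of order `r + 1` of every piece, and
  -- `IsNullChain.eq_zero` applies.
  have hpos : ∀ x ∈ S, x ≠ 0 → 0 < Q x := by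
    rintro x ⟨hx, hx'⟩ hx0
    by_contra! hle
    refine hx0 (funext fun i => eq_zero_of_polyOf_eq_zero ?_)
    have h0 := (Finset.sum_eq_zero_iff_of_nonneg fun j _ =>
      boundaryForm_zero_le_one (hdeg (x j))).1
      (le_antisymm hle (Finset.sum_nonneg fun j _ => boundaryForm_zero_le_one (hdeg (x j))))
    let q : ℕ → ℝ[X] := fun i => if h : i < r + 1 then P (x ⟨i, h⟩) else 0
    have hq : ∀ i (h : i < r + 1), q i = P (x ⟨i, h⟩) := fun i h => dif_pos h
    have hchain : IsNullChain r (r + 1) q :=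
      { natDegree_le := fun i h => by
          rw [hq i h]
          exact hdeg _
        eval_zero := fun i h => by
          rw [hq i h]
          exact hx _
        join := fun i h k hk => by
          rw [hq i (by omega), hq (i + 1) h]
          exact hx' _ _ rfl k hk }
    have := hchain.eq_zero (fun j hj => by
      rw [hq j hj]
      exact iterate_derivative_eq_zero_of_boundaryForm (hdeg _)
        (sub_eq_zero.1 (h0 ⟨j, hj⟩ (Finset.mem_univ _)))) i i.2
    rwa [hq i i.2] at this
  obtain ⟨κ, hκ, hd⟩ := exists_mul_norm_sq_le S hQ hom hpos
  refine ⟨κ, hκ, fun q hq => ?_⟩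
  let x : Fin (r + 1) → Fin (2 * r + 2) → ℝ := fun i j => (q i).coeff j
  have hx : ∀ i, P (x i) = q i := fun i =>
    polyOf_coeff (Nat.lt_succ_of_le (hq.natDegree_le i i.2))
  have hxS : x ∈ S := by
    refine ⟨fun i => ?_, fun i j hij k hk => ?_⟩
    · rw [hx]
      exact hq.eval_zero i i.2
    · rw [hx, hx, hij]
      exact hq.join i (hij ▸ j.2) k hk
  have h1 := hd x hxS
  simp only [Q, hx] at h1
  rw [Fin.sum_univ_eq_sum_range
    (fun i => boundaryForm r (q i) 1 - boundaryForm r (q i) 0) (r + 1)] at h1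
  refine le_trans ?_ h1
  gcongr
  exact norm_le_pi_norm x 0

theorem abs_boundaryForm_polyOf_le (r n : ℕ) (x : Fin n → ℝ) :
    |boundaryForm r (polyOf n x) 0| ≤ (r + 1) * (n * n.factorial : ℝ) ^ 2 * ‖x‖ ^ 2 := by
  have h0 : (0 : ℝ) ∈ Icc (0 : ℝ) 1 := by simp
  refine (Finset.abs_sum_le_sum_abs _ _).trans ?_
  calc _ ≤ ∑ l ∈ Finset.range (r + 1), ((n * n.factorial : ℝ) * ‖x‖) ^ 2 := by
        refine Finset.sum_le_sum fun l _ => ?_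
        rw [abs_mul, abs_mul, abs_pow, abs_neg, abs_one, one_pow, one_mul, sq]
        exact mul_le_mul (abs_eval_iterate_derivative_polyOf_le n x _ h0)
          (abs_eval_iterate_derivative_polyOf_le n x _ h0) (abs_nonneg _) (by positivity)
    _ = _ := by
        rw [Finset.sum_const, Finset.card_range, nsmul_eq_mul]
        push_cast
        ring

/-- A bounded infinite null chain decays. -/
theorem exists_decay_of_isNullChain {r : ℕ} {q : ℕ → ℝ[X]} (h : ∀ n, IsNullChain r n q) {B : ℝ}
    (hB : ∀ i, ∀ t ∈ Icc (0 : ℝ) 1, |(q i).eval t| ≤ B) :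
    ∃ M : ℝ, 0 ≤ M ∧ ∀ (i k : ℕ), ∀ t ∈ Icc (0 : ℝ) 1,
      |(derivative^[k] (q i)).eval t| ≤ M / (1 + (i : ℝ)) ^ 3 := by
  have hdeg : ∀ i, (q i).natDegree ≤ 2 * r + 1 := fun i => (h (i + 1)).natDegree_le i (by omega)
  have hzero : ∀ i, (q i).eval 0 = 0 := fun i => (h (i + 1)).eval_zero i (by omega)
  have hjoin : ∀ i, ∀ k ≤ 2 * r,
    (derivative^[k] (q i)).eval 1 = (derivative^[k] (q (i + 1))).eval 0 :=
    fun i => (h (i + 2)).join i (by omega)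
  let x : ℕ → Fin (2 * r + 2) → ℝ := fun i j => (q i).coeff j
  have hx : ∀ i, polyOf (2 * r + 2) (x i) = q i := fun i =>
    polyOf_coeff (Nat.lt_succ_of_le (hdeg i))
  set β : ℕ → ℝ := fun i => boundaryForm r (q i) 0 with hβ
  have hβ1 : ∀ i, boundaryForm r (q i) 1 = β (i + 1) := by
    intro i
    simp only [hβ, boundaryForm]
    rw [Finset.sum_range_succ, Finset.sum_range_succ]
    congr 1
    · refine Finset.sum_congr rfl fun l hl => ?_
      have := Finset.mem_range.1 hl
      rw [hjoin i _ (by omega), hjoin i _ (by omega)]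
    -- The last term contains the derivative of order `2r + 1`, which may jump at the node, but it
    -- is multiplied by the value of the piece there, which is zero.
    · have h1 := hjoin i 0 (by omega)
      have h2 := hzero (i + 1)
      simp only [Function.iterate_zero, id] at h1
      simp [h1, h2]
  have hmono : Monotone β := monotone_nat_of_le_succ fun i => by
    rw [← hβ1]
    exact boundaryForm_mono (hdeg i) zero_le_one
  obtain ⟨κ, hκ, hκ'⟩ := exists_mul_norm_sq_le_energy r
  have hcoer : ∀ i, κ * ‖x i‖ ^ 2 ≤ β (i + (r + 1)) - β i := by
    intro i
    have h1 := hκ' (fun j => q (i + j))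
      { natDegree_le := fun j _ => hdeg _
        eval_zero := fun j _ => hzero _
        join := fun j _ => hjoin _ }
    simp only [hβ1, add_zero] at h1
    refine h1.trans (le_of_eq ?_)
    exact Finset.sum_range_sub (fun j => β (i + j)) (r + 1)
  set D : ℝ := ((2 * r + 2 : ℕ) * (2 * r + 2).factorial : ℝ) with hD
  have hD0 : 0 ≤ D := by positivity
  have habs : ∀ i, |β i| ≤ (r + 1) * D ^ 2 * ‖x i‖ ^ 2 := by
    intro i
    have := abs_boundaryForm_polyOf_le r (2 * r + 2) (x i)
    rwa [hx] at this
  obtain ⟨B', hB'0, hB'⟩ := exists_norm_sq_le_of_abs_eval_le (2 * r + 2) B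
  have hxB : ∀ i, ‖x i‖ ^ 2 ≤ B' := fun i => hB' (x i) fun t ht => by
    rw [hx]
    exact hB i t ht
  -- The form is quadratic in the coefficients, hence at most a constant times `‖x i‖²`; coercivity
  -- bounds this by the increment over `r + 1` cells.
  obtain ⟨M, hM, hMd⟩ := exists_le_div_pow_of_abs_le (β := β) (B := (r + 1) * D ^ 2 * B')
    (C := (r + 1) * D ^ 2 / κ) (N := r + 1) hmono (Nat.succ_pos r)
    (fun i => (le_abs_self _).trans ((habs i).trans (by gcongr; exact hxB i))) (by positivity)
    (fun i => (habs i).trans (by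
      rw [div_mul_eq_mul_div, le_div_iff₀ hκ, mul_assoc, mul_comm _ κ]
      gcongr
      exact hcoer i))
  refine ⟨D * √(M / κ), by positivity, fun i k t ht => ?_⟩
  have h1 : ‖x i‖ ≤ √(M / κ) / (1 + (i : ℝ)) ^ 3 := by
    rw [← abs_of_nonneg (norm_nonneg (x i))]
    refine abs_le_of_sq_le_sq ?_ (by positivity)
    rw [div_pow, Real.sq_sqrt (by positivity), div_div, ← pow_mul, le_div_iff₀ (by positivity)]
    have h2 := (hcoer i).trans (hMd i)
    rw [le_div_iff₀ (by positivity)] at h2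
    refine le_trans (le_of_eq ?_) h2
    ring
  have h3 := abs_eval_iterate_derivative_polyOf_le (2 * r + 2) (x i) k ht
  rw [hx, ← hD] at h3
  calc _ ≤ D * ‖x i‖ := h3
    _ ≤ D * (√(M / κ) / (1 + (i : ℝ)) ^ 3) := by gcongr
    _ = _ := by ring

theorem natDegree_comp_linear_le {P L : ℝ[X]} {n : ℕ} (hP : P.natDegree ≤ n)
    (hL : L.natDegree ≤ 1) : (P.comp L).natDegree ≤ n := by
  refine natDegree_comp_le.trans ?_
  calc P.natDegree * L.natDegree ≤ n * 1 := Nat.mul_le_mul hP hL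
    _ = n := mul_one n

theorem exists_abs_eval_iterate_derivative_le (p : ℝ[X]) : ∃ M : ℝ, 0 ≤ M ∧
    ∀ (k : ℕ), ∀ t ∈ Icc (0 : ℝ) 1, |(derivative^[k] p).eval t| ≤ M := by
  have h := polyOf_coeff (Nat.lt_succ_self p.natDegree)
  refine ⟨((p.natDegree + 1 : ℕ) * (p.natDegree + 1).factorial : ℝ) *
    ‖fun i : Fin (p.natDegree + 1) => p.coeff i‖, by positivity, fun k t ht => ?_⟩
  have := abs_eval_iterate_derivative_polyOf_le (p.natDegree + 1) (fun i => p.coeff i) k ht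
  rwa [h] at this

/-! ### Cardinal splines are piecewise cardinal functions. -/

namespace IsCardinalSpline

variable {r : ℕ}

theorem rescale {Δx : ℝ} (hΔx : 0 < Δx) {j : ℤ} {ψ : ℝ → ℝ} (h : IsCardinalSpline r Δx j ψ) :
    IsCardinalSpline r 1 0 fun y => ψ ((y + j) * Δx) where
  contDiff := h.contDiff.comp (by fun_prop)
  piecewise m := by
    obtain ⟨P, hP, hPe⟩ := h.piecewise (m + j)
    refine ⟨P.comp (C Δx * (X + C (j : ℝ))), natDegree_comp_linear_le hP ?_, fun x hx => ?_⟩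
    · refine (natDegree_C_mul_le _ _).trans ?_
      rw [natDegree_X_add_C]
    · rw [mul_one, mul_one] at hx
      rw [hPe]
      · simp [mul_comm]
      · push_cast
        constructor
        · gcongr
          exact hx.1
        · have : x + j ≤ (m : ℝ) + j + 1 := by linarith [hx.2]
          gcongr
  bounded := by
    obtain ⟨M, hM⟩ := h.bounded
    exact ⟨M, fun x => hM _⟩
  cardinal i := by
    have := h.cardinal (i + j)
    push_cast at this
    simp [this]

theorem comp_neg {F : ℝ → ℝ} (h : IsCardinalSpline r 1 0 F) :
    IsCardinalSpline r 1 0 fun y => F (-y) where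
  contDiff := h.contDiff.comp contDiff_neg
  piecewise m := by
    obtain ⟨P, hP, hPe⟩ := h.piecewise (-m - 1)
    refine ⟨P.comp (-X), natDegree_comp_linear_le hP (by simp), fun x hx => ?_⟩
    rw [hPe]
    · simp
    · push_cast
      constructor <;> linarith [hx.1, hx.2]
  bounded := by
    obtain ⟨M, hM⟩ := h.bounded
    exact ⟨M, fun x => hM _⟩
  cardinal i := by
    have := h.cardinal (-i)
    push_cast at this
    simpa using this

theorem exists_pieces {F : ℝ → ℝ} (h : IsCardinalSpline r 1 0 F) :
    ∃ p : ℤ → ℝ[X], (∀ m, (p m).natDegree ≤ 2 * r + 1) ∧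
      ∀ (m : ℤ), ∀ t ∈ Icc (0 : ℝ) 1, F (m + t) = (p m).eval t := by
  choose P hP hPe using h.piecewise
  refine ⟨fun m => (P m).comp (X + C (m : ℝ)), fun m => natDegree_comp_linear_le (hP m)
    (natDegree_X_add_C _).le, fun m t ht => ?_⟩
  rw [hPe m]
  · simp [add_comm]
  · constructor <;> linarith [ht.1, ht.2]

variable {F : ℝ → ℝ} {p : ℤ → ℝ[X]}

/-- Inside the cell the derivatives agree locally; continuity of the derivatives up to order `2r`
extends this to the endpoints. -/
theorem iteratedDeriv_eq (h : IsCardinalSpline r 1 0 F)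
    (hp : ∀ (m : ℤ), ∀ t ∈ Icc (0 : ℝ) 1, F (m + t) = (p m).eval t) (m : ℤ) {k : ℕ}
    (hk : k ≤ 2 * r) {t : ℝ} (ht : t ∈ Icc (0 : ℝ) 1) :
    iteratedDeriv k F (m + t) = (derivative^[k] (p m)).eval t := by
  induction k generalizing t with
  | zero => exact hp m t ht
  | succ k ih =>
    have hcont : Continuous fun t : ℝ => iteratedDeriv (k + 1) F (m + t) :=
      (h.contDiff.continuous_iteratedDeriv (k + 1) (by exact_mod_cast hk)).comp (by fun_prop)
    have hEq : EqOn (fun t : ℝ => iteratedDeriv (k + 1) F (m + t))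
        (fun t => (derivative^[k + 1] (p m)).eval t) (Ioo 0 1) := by
      intro s hs
      have h1 : (fun t : ℝ => iteratedDeriv k F (m + t)) =ᶠ[𝓝 s]
          fun t => (derivative^[k] (p m)).eval t := by
        filter_upwards [Ioo_mem_nhds hs.1 hs.2] with w hw
        exact ih (by omega) (Ioo_subset_Icc_self hw)
      have h2 := h1.deriv_eq
      rw [Polynomial.deriv, ← Function.iterate_succ_apply' (⇑derivative), deriv_comp_const_add,
        ← iteratedDeriv_succ] at h2
      exact h2
    have h3 := hEq.closure hcont (derivative^[k + 1] (p m)).continuous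
    rw [closure_Ioo zero_ne_one] at h3
    exact h3 ht

theorem join (h : IsCardinalSpline r 1 0 F)
    (hp : ∀ (m : ℤ), ∀ t ∈ Icc (0 : ℝ) 1, F (m + t) = (p m).eval t) (m : ℤ) {k : ℕ}
    (hk : k ≤ 2 * r) :
    (derivative^[k] (p m)).eval 1 = (derivative^[k] (p (m + 1))).eval 0 := by
  rw [← h.iteratedDeriv_eq hp m hk (by simp), ← h.iteratedDeriv_eq hp (m + 1) hk (by simp)]
  push_cast
  rw [add_zero]

/-- The chain starts at cell `1`, since cell `0` takes the value `1` at its left end. -/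
theorem exists_decay_right (h : IsCardinalSpline r 1 0 F)
    (hdeg : ∀ m, (p m).natDegree ≤ 2 * r + 1)
    (hp : ∀ (m : ℤ), ∀ t ∈ Icc (0 : ℝ) 1, F (m + t) = (p m).eval t) :
    ∃ M : ℝ, 0 ≤ M ∧ ∀ (i k : ℕ), ∀ t ∈ Icc (0 : ℝ) 1,
      |(derivative^[k] (p (i + 1))).eval t| ≤ M / (1 + (i : ℝ)) ^ 3 := by
  obtain ⟨B, hB⟩ := h.bounded
  refine exists_decay_of_isNullChain (r := r) (q := fun i : ℕ => p (i + 1)) (B := B) (fun n =>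
    { natDegree_le := fun i _ => hdeg _
      eval_zero := fun i _ => ?_
      join := fun i _ k hk => ?_ }) fun i t ht => ?_
  · have h1 := h.cardinal (i + 1)
    rw [← hp _ 0 (by simp)]
    rw [mul_one, if_neg (by omega)] at h1
    simpa using h1
  · have := h.join hp (i + 1) hk
    push_cast
    exact this
  · rw [← hp _ t ht]
    exact hB _

theorem exists_decay (h : IsCardinalSpline r 1 0 F)
    (hdeg : ∀ m, (p m).natDegree ≤ 2 * r + 1)
    (hp : ∀ (m : ℤ), ∀ t ∈ Icc (0 : ℝ) 1, F (m + t) = (p m).eval t) :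
    ∃ M : ℝ, 0 ≤ M ∧ ∀ (m : ℤ) (k : ℕ), ∀ t ∈ Icc (0 : ℝ) 1,
      |(derivative^[k] (p m)).eval t| ≤ M / (1 + |(m : ℝ)|) ^ 3 := by
  obtain ⟨M₁, hM₁, h₁⟩ := h.exists_decay_right hdeg hp
  obtain ⟨M₂, hM₂, h₂⟩ := h.comp_neg.exists_decay_right (p := fun m => (p (-m - 1)).comp (1 - X))
    (fun m => natDegree_comp_linear_le (hdeg _) (by
      refine (natDegree_sub_le _ _).trans ?_
      simp)) (fun m t ht => by
      have := hp (-m - 1) (1 - t) ⟨by linarith [ht.2], by linarith [ht.1]⟩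
      push_cast at this
      simp only [eval_comp, eval_sub, eval_one, eval_X]
      rw [← this]
      congr 1
      ring)
  have h₂' : ∀ (i k : ℕ), ∀ t ∈ Icc (0 : ℝ) 1,
      |(derivative^[k] (p (-i - 2))).eval t| ≤ M₂ / (1 + (i : ℝ)) ^ 3 := by
    intro i k t ht
    have := h₂ i k (1 - t) ⟨by linarith [ht.2], by linarith [ht.1]⟩
    rw [iterate_derivative_comp_one_sub_X, eval_mul, eval_pow, eval_neg, eval_one, abs_mul,
      abs_pow, abs_neg, abs_one, one_pow, one_mul, eval_comp, eval_sub, eval_one, eval_X,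
      sub_sub_cancel, show -((i : ℤ) + 1) - 1 = -i - 2 by ring] at this
    exact this
  obtain ⟨M₃, hM₃, h₃⟩ := exists_abs_eval_iterate_derivative_le (p 0)
  obtain ⟨M₄, hM₄, h₄⟩ := exists_abs_eval_iterate_derivative_le (p (-1))
  -- On the cells `i + 1`, `-i - 2`, `0`, `-1` the weight `1 + |m|` is at most `2 (1 + i)`, `3 (1 +
  -- i)`, `1`, `2`; the factors are the cubes.
  refine ⟨8 * M₁ + 27 * M₂ + M₃ + 8 * M₄, by positivity, fun m k t ht => ?_⟩
  rw [le_div_iff₀ (by positivity)]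
  have hcase : m = 0 ∨ m = -1 ∨ (∃ i : ℕ, m = i + 1) ∨ ∃ i : ℕ, m = -i - 2 := by
    rcases lt_trichotomy m 0 with hm | hm | hm
    · by_cases h' : m = -1
      · exact Or.inr (Or.inl h')
      · exact Or.inr (Or.inr (Or.inr ⟨(-m - 2).toNat, by omega⟩))
    · exact Or.inl hm
    · exact Or.inr (Or.inr (Or.inl ⟨(m - 1).toNat, by omega⟩))
  rcases hcase with rfl | rfl | ⟨i, rfl⟩ | ⟨i, rfl⟩
  · have := h₃ k t ht
    norm_num
    linarith
  · have := h₄ k t ht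
    norm_num
    linarith
  · have h1 := h₁ i k t ht
    rw [le_div_iff₀ (by positivity)] at h1
    have h2 : 1 + |(((i : ℤ) + 1 : ℤ) : ℝ)| ≤ 2 * (1 + (i : ℝ)) := by
      push_cast
      rw [abs_of_nonneg (by positivity)]
      linarith [(Nat.cast_nonneg i : (0 : ℝ) ≤ i)]
    calc _ ≤ |(derivative^[k] (p (i + 1))).eval t| * (2 * (1 + (i : ℝ))) ^ 3 := by gcongr
      _ = 8 * (|(derivative^[k] (p (i + 1))).eval t| * (1 + (i : ℝ)) ^ 3) := by ring
      _ ≤ 8 * M₁ := by gcongr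
      _ ≤ _ := by linarith
  · have h1 := h₂' i k t ht
    rw [le_div_iff₀ (by positivity)] at h1
    have h2 : 1 + |((-(i : ℤ) - 2 : ℤ) : ℝ)| ≤ 3 * (1 + (i : ℝ)) := by
      push_cast
      rw [show -(i : ℝ) - 2 = -(i + 2) by ring, abs_neg, abs_of_nonneg (by positivity)]
      linarith [(Nat.cast_nonneg i : (0 : ℝ) ≤ i)]
    calc _ ≤ |(derivative^[k] (p (-i - 2))).eval t| * (3 * (1 + (i : ℝ))) ^ 3 := by gcongr
      _ = 27 * (|(derivative^[k] (p (-i - 2))).eval t| * (1 + (i : ℝ)) ^ 3) := by ring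
      _ ≤ 27 * M₂ := by gcongr
      _ ≤ _ := by linarith

/-- The bounded cardinal spline of odd degree, on the unit grid, is a piecewise cardinal function
whose jumps are multiples of `X ^ (2r + 1)`. -/
theorem exists_isPiecewiseCardinal (h : IsCardinalSpline r 1 0 F) :
    ∃ p, IsPiecewiseCardinal r (fun s => if s = r then 1 else 0) p F := by
  obtain ⟨p, hdeg, hp⟩ := h.exists_pieces
  refine ⟨p, hdeg, hp, fun m => ?_, fun i => by simpa using h.cardinal i, h.exists_decay hdeg hp⟩
  set d := p m - (p (m - 1)).comp (X + 1) with hd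
  have hX : (X + 1 : ℝ[X]).natDegree ≤ 1 := (natDegree_X_add_C (1 : ℝ)).le
  have hddeg : d.natDegree ≤ 2 * r + 1 :=
    (natDegree_sub_le_of_le (hdeg m) (natDegree_comp_linear_le (hdeg _) hX)).trans (max_self _).le
  -- All derivatives of `d` at `0` up to order `2r` vanish, so only its top coefficient is left;
  -- `(-1) ^ r` undoes the sign in `alternatingOdd`.
  refine ⟨(-1) ^ r * d.coeff (2 * r + 1), ?_⟩
  have hW : alternatingOdd r (fun s => if s = r then 1 else 0) =
      C ((-1) ^ r) * X ^ (2 * r + 1) := by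
    rw [alternatingOdd, Finset.sum_eq_single r]
    · simp
    · intro s _ hs
      simp [hs]
    · simp
  have hsign : (-1 : ℝ) ^ r * d.coeff (2 * r + 1) * (-1) ^ r = d.coeff (2 * r + 1) := by
    rw [mul_right_comm, ← mul_pow, neg_one_mul, neg_neg, one_pow, one_mul]
  rw [hW, ← mul_assoc, ← C_mul, hsign]
  ext k
  rcases lt_trichotomy k (2 * r + 1) with hk | hk | hk
  · rw [coeff_C_mul_X_pow, if_neg (by omega)]
    refine coeff_eq_zero_of_eval_iterate_derivative ?_
    rw [hd, iterate_derivative_sub, iterate_derivative_comp_X_add_one]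
    have := h.join hp (m - 1) (k := k) (by omega)
    rw [sub_add_cancel] at this
    simp [this]
  · rw [hk]
    simp
  · rw [coeff_C_mul_X_pow, if_neg (by omega)]
    exact coeff_eq_zero_of_natDegree_lt (by omega)

end IsCardinalSpline

/-! ### Lagrange cardinal functions are piecewise cardinal functions. -/

/-- Multiplication by `(r + 1)² - x²` replaces `a s` by `(r + 1)² a s + a (s - 1)`, which keeps the
signs. The vanishing of `a` beyond `r` serves the induction. -/
theorem exists_eval_alternatingOdd_eq_prod (r : ℕ) : ∃ a : ℕ → ℝ, (∀ s, 0 ≤ a s) ∧ 0 < a r ∧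
    (∀ s, r < s → a s = 0) ∧ ∀ x : ℝ, (alternatingOdd r a).eval x =
      x * ∏ l ∈ Finset.range r, (((l : ℝ) + 1) ^ 2 - x ^ 2) := by
  have heval : ∀ (r : ℕ) (a : ℕ → ℝ) (x : ℝ), (alternatingOdd r a).eval x =
      ∑ s ∈ Finset.range (r + 1), (-1) ^ s * a s * x ^ (2 * s + 1) := by
    intro r a x
    simp [alternatingOdd, eval_finsetSum]
  induction r with
  | zero =>
    refine ⟨fun s => if s = 0 then 1 else 0, fun s => by dsimp only; split_ifs <;> norm_num, by simp,
      fun s hs => by simp [Nat.pos_iff_ne_zero.1 hs], fun x => by simp [heval]⟩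
  | succ r ih =>
    obtain ⟨a, ha, har, haz, hae⟩ := ih
    refine ⟨fun s => ((r : ℝ) + 1) ^ 2 * a s + if s = 0 then 0 else a (s - 1), fun s => ?_, ?_,
      fun s hs => ?_, fun x => ?_⟩
    · have := ha s
      have := ha (s - 1)
      dsimp only
      split_ifs <;> positivity
    · have := ha (r + 1)
      simp only [Nat.add_eq_zero_iff, one_ne_zero, and_false, if_false, Nat.add_sub_cancel]
      positivity
    · simp [haz s (by omega), haz (s - 1) (by omega)]
    · rw [Finset.prod_range_succ, ← mul_assoc, ← hae, heval, heval]
      have h1 : ∑ s ∈ Finset.range (r + 1 + 1), (-1) ^ s * a s * x ^ (2 * s + 1) =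
          ∑ s ∈ Finset.range (r + 1), (-1) ^ s * a s * x ^ (2 * s + 1) := by
        rw [Finset.sum_range_succ, haz (r + 1) (by omega)]
        simp
      have h2 : ∑ s ∈ Finset.range (r + 1 + 1), (-1) ^ s * (if s = 0 then 0 else a (s - 1)) *
          x ^ (2 * s + 1) =
          -x ^ 2 * ∑ s ∈ Finset.range (r + 1), (-1) ^ s * a s * x ^ (2 * s + 1) := by
        rw [Finset.sum_range_succ', Finset.mul_sum]
        simp only [if_true, mul_zero, zero_mul, add_zero]
        refine Finset.sum_congr rfl fun s _ => ?_
        simp only [Nat.add_eq_zero_iff, one_ne_zero, and_false, if_false, Nat.add_sub_cancel]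
        ring
      calc _ = ((r : ℝ) + 1) ^ 2 *
            ∑ s ∈ Finset.range (r + 1 + 1), (-1) ^ s * a s * x ^ (2 * s + 1) +
          ∑ s ∈ Finset.range (r + 1 + 1), (-1) ^ s * (if s = 0 then 0 else a (s - 1)) *
            x ^ (2 * s + 1) := by
            rw [Finset.mul_sum, ← Finset.sum_add_distrib]
            exact Finset.sum_congr rfl fun s _ => by ring
        _ = _ := by
            rw [h1, h2]
            ring

theorem natDegree_alternatingOdd_le (r : ℕ) (a : ℕ → ℝ) :
    (alternatingOdd r a).natDegree ≤ 2 * r + 1 := by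
  refine natDegree_sum_le_of_forall_le _ _ fun s hs => ?_
  refine (natDegree_C_mul_X_pow_le _ _).trans ?_
  have := Finset.mem_range.1 hs
  omega

theorem coeff_alternatingOdd (r : ℕ) (a : ℕ → ℝ) :
    (alternatingOdd r a).coeff (2 * r + 1) = (-1) ^ r * a r := by
  rw [alternatingOdd, finsetSum_coeff, Finset.sum_eq_single r]
  · rw [coeff_C_mul_X_pow, if_pos rfl]
  · intro s _ hs
    rw [coeff_C_mul_X_pow, if_neg (by omega)]
  · simp

theorem eq_C_mul_of_eval_eq_zero {P Q : ℝ[X]} {n : ℕ} (hP : P.natDegree ≤ n)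
    (hQ : Q.natDegree ≤ n) (hQn : Q.coeff n ≠ 0) {s : Finset ℝ} (hs : s.card = n)
    (hPs : ∀ x ∈ s, P.eval x = 0) (hQs : ∀ x ∈ s, Q.eval x = 0) : ∃ c : ℝ, P = C c * Q := by
  refine ⟨P.coeff n / Q.coeff n, ?_⟩
  rw [← sub_eq_zero]
  refine eq_zero_of_degree_lt_of_eval_finset_eq_zero s ?_ fun x hx => by simp [hPs x hx, hQs x hx]
  rw [hs, degree_lt_iff_coeff_zero]
  intro m hm
  rcases hm.eq_or_lt with rfl | hm
  · rw [coeff_sub, coeff_C_mul, div_mul_cancel₀ _ hQn, sub_self]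
  · rw [coeff_sub, coeff_C_mul, coeff_eq_zero_of_natDegree_lt (hP.trans_lt hm),
      coeff_eq_zero_of_natDegree_lt (hQ.trans_lt hm)]
    simp

theorem eval_basis_eq_prod (s : Finset ℤ) (v : ℤ → ℝ) (i : ℤ) (x : ℝ) :
    (Lagrange.basis s v i).eval x = ∏ l ∈ s.erase i, (v i - v l)⁻¹ * (x - v l) := by
  simp [Lagrange.basis, Lagrange.basisDivisor, eval_prod]

theorem lagrangeCardinal_eq {r : ℕ} {Δx : ℝ} (hΔx : 0 < Δx) (j : ℤ) (x : ℝ) :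
    lagrangeCardinal r Δx j x = lagrangeCardinal r 1 0 (x / Δx - j) := by
  have hfl : ⌊(x / Δx - j) / 1⌋ = ⌊x / Δx⌋ - j := by
    rw [div_one, Int.floor_sub_intCast]
  have hmem : ∀ l, l ∈ stencil r Δx x ↔ l - j ∈ stencil r 1 (x / Δx - j) := by
    intro l
    simp only [stencil, hfl, Finset.mem_Icc]
    omega
  have hmem' := hmem j
  rw [sub_self] at hmem'
  unfold lagrangeCardinal
  by_cases h : j ∈ stencil r Δx x
  · rw [if_pos h, if_pos (hmem'.1 h), eval_basis_eq_prod, eval_basis_eq_prod]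
    refine Finset.prod_nbij' (· - j) (· + j) ?_ ?_ ?_ ?_ ?_
    · intro l hl
      rw [Finset.mem_erase] at hl ⊢
      exact ⟨sub_ne_zero.2 hl.1, (hmem l).1 hl.2⟩
    · intro l hl
      rw [Finset.mem_erase] at hl ⊢
      refine ⟨by simpa using hl.1, (hmem _).2 ?_⟩
      simpa using hl.2
    · intro l _
      simp
    · intro l _
      simp
    · intro l _
      push_cast
      rw [← sub_mul, mul_inv, mul_assoc]
      congr 1
      · ring
      · field_simp
        ring
  · rw [if_neg h, if_neg (fun h' => h (hmem'.2 h'))]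

/-- The `2r + 2` indices of the stencil of the unit cell `[m, m + 1]`. -/
noncomputable def unitStencil (r : ℕ) (m : ℤ) : Finset ℤ := Finset.Icc (m - r) (m + r + 1)

/-- The polynomial which agrees on the unit cell `[m, m + 1]` with the Lagrange cardinal
function. -/
noncomputable def lagrangePiece (r : ℕ) (m : ℤ) : ℝ[X] :=
  if 0 ∈ unitStencil r m then Lagrange.basis (unitStencil r m) (fun l : ℤ => (l : ℝ)) 0 else 0

theorem lagrangeCardinal_eq_eval (r : ℕ) (x : ℝ) :
    lagrangeCardinal r 1 0 x = (lagrangePiece r ⌊x⌋).eval x := by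
  have : stencil r 1 x = unitStencil r ⌊x⌋ := by simp [stencil, unitStencil]
  rw [lagrangeCardinal, lagrangePiece, this]
  split_ifs <;> simp

theorem eval_lagrangePiece {r : ℕ} {m l : ℤ} (hl : l ∈ unitStencil r m) :
    (lagrangePiece r m).eval (l : ℝ) = if l = 0 then 1 else 0 := by
  have hinj : InjOn (fun l : ℤ => (l : ℝ)) (unitStencil r m) := Int.cast_injective.injOn
  rw [lagrangePiece]
  split_ifs with h0 h1 h1
  · subst h1
    exact Lagrange.eval_basis_self hinj h0
  · exact Lagrange.eval_basis_of_ne (Ne.symm h1) hl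
  · exact absurd (h1 ▸ hl) h0
  · simp

theorem natDegree_lagrangePiece_le (r : ℕ) (m : ℤ) :
    (lagrangePiece r m).natDegree ≤ 2 * r + 1 := by
  have hinj : InjOn (fun l : ℤ => (l : ℝ)) (unitStencil r m) := Int.cast_injective.injOn
  rw [lagrangePiece]
  split_ifs with h0
  · rw [Lagrange.natDegree_basis hinj h0, unitStencil, Int.card_Icc]
    omega
  · simp

theorem lagrangeCardinal_intCast (r : ℕ) (i : ℤ) :
    lagrangeCardinal r 1 0 i = if i = 0 then 1 else 0 := by
  rw [lagrangeCardinal_eq_eval, Int.floor_intCast]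
  refine eval_lagrangePiece ?_
  rw [unitStencil, Finset.mem_Icc]
  omega

theorem lagrangeCardinal_eq_eval_of_mem_Icc (r : ℕ) (m : ℤ) {t : ℝ} (ht : t ∈ Icc (0 : ℝ) 1) :
    lagrangeCardinal r 1 0 (m + t) = (lagrangePiece r m).eval (m + t) := by
  -- At `t = 1` the floor passes to the next cell, but both pieces interpolate the same value at `m
  -- + 1`.
  rcases ht.2.eq_or_lt with rfl | h1
  · have h2 := lagrangeCardinal_intCast r (m + 1)
    have h3 := eval_lagrangePiece (r := r) (m := m) (l := m + 1)
      (by rw [unitStencil, Finset.mem_Icc]; omega)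
    push_cast at h2 h3
    rw [h2, h3]
  · have : ⌊(m : ℝ) + t⌋ = m := by
      rw [Int.floor_intCast_add, Int.floor_eq_zero_iff.2 ⟨ht.1, h1⟩, add_zero]
    rw [lagrangeCardinal_eq_eval, this]

/-- The Lagrange cardinal function on the unit grid is a piecewise cardinal function whose jumps
are multiples of `x ∏ (l² - x²)`. -/
theorem exists_isPiecewiseCardinal_lagrange (r : ℕ) : ∃ a : ℕ → ℝ, (∀ s, 0 ≤ a s) ∧ 0 < a r ∧
    ∃ p, IsPiecewiseCardinal r a p (lagrangeCardinal r 1 0) := by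
  obtain ⟨a, ha, har, -, hae⟩ := exists_eval_alternatingOdd_eq_prod r
  have hX : ∀ c : ℝ, (X + C c : ℝ[X]).natDegree ≤ 1 := fun c => (natDegree_X_add_C c).le
  refine ⟨a, ha, har, fun m => (lagrangePiece r m).comp (X + C (m : ℝ)),
    fun m => natDegree_comp_linear_le (natDegree_lagrangePiece_le r m) (hX _), fun m t ht => ?_,
    fun m => ?_, lagrangeCardinal_intCast r, ?_⟩
  · rw [lagrangeCardinal_eq_eval_of_mem_Icc r m ht]
    simp [add_comm]
  -- Consecutive stencils share the `2r + 1` nodes `m - r, …, m + r`, where both pieces interpolate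
  -- the same data. In local coordinates these are the roots `-r, …, r` of the product, so the
  -- degree bound leaves one free factor.
  · refine eq_C_mul_of_eval_eq_zero (n := 2 * r + 1)
      (s := (Finset.Icc (-r : ℤ) r).image (fun l : ℤ => (l : ℝ))) ?_
      (natDegree_alternatingOdd_le r a) ?_ ?_ ?_ ?_
    · refine (natDegree_sub_le_of_le
        (natDegree_comp_linear_le (natDegree_lagrangePiece_le r m) (hX _))
        (natDegree_comp_linear_le
          (natDegree_comp_linear_le (natDegree_lagrangePiece_le r (m - 1)) (hX _)) ?_)).trans
          (max_self _).le
      exact hX 1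
    · rw [coeff_alternatingOdd]
      exact mul_ne_zero (pow_ne_zero _ (by norm_num)) har.ne'
    · rw [Finset.card_image_of_injective _ Int.cast_injective, Int.card_Icc]
      omega
    · intro x hx
      obtain ⟨l, hl, rfl⟩ := Finset.mem_image.1 hx
      rw [Finset.mem_Icc] at hl
      have h1 := eval_lagrangePiece (r := r) (m := m) (l := l + m)
        (by rw [unitStencil, Finset.mem_Icc]; omega)
      have h2 := eval_lagrangePiece (r := r) (m := m - 1) (l := l + m)
        (by rw [unitStencil, Finset.mem_Icc]; omega)
      rw [← h1] at h2
      push_cast at h2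
      simp only [eval_sub, eval_comp, eval_add, eval_X, eval_C, eval_one]
      push_cast
      rw [show (l : ℝ) + 1 + (m - 1) = l + m by ring, h2, sub_self]
    · intro x hx
      obtain ⟨l, hl, rfl⟩ := Finset.mem_image.1 hx
      rw [Finset.mem_Icc] at hl
      rw [hae]
      by_cases hl0 : l = 0
      · simp [hl0]
      · rw [Finset.prod_eq_zero (i := l.natAbs - 1), mul_zero]
        · rw [Finset.mem_range]
          omega
        · have h1 : ((l.natAbs - 1 : ℕ) : ℝ) + 1 = |(l : ℝ)| := by
            rw [← Int.cast_abs, Int.abs_eq_natAbs]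
            have : l.natAbs - 1 + 1 = l.natAbs := by omega
            exact_mod_cast this
          rw [h1, sq_abs, sub_self]
  -- Compact support: the node `0` lies in the stencil of cell `m` only for `-r - 1 ≤ m ≤ r`.
  · choose M hM hMd using fun m : ℤ =>
      exists_abs_eval_iterate_derivative_le ((lagrangePiece r m).comp (X + C (m : ℝ)))
    refine ⟨(∑ m ∈ Finset.Icc (-r - 1 : ℤ) r, M m) * (r + 2) ^ 3,
      mul_nonneg (Finset.sum_nonneg fun m _ => hM m) (by positivity), fun m k t ht => ?_⟩
    rw [le_div_iff₀ (by positivity)]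
    by_cases hm : m ∈ Finset.Icc (-r - 1 : ℤ) r
    · have h1 : |(m : ℝ)| ≤ r + 1 := by
        rw [Finset.mem_Icc] at hm
        rw [abs_le]
        constructor
        · have := hm.1
          have : -((r : ℤ) + 1) ≤ m := by omega
          exact_mod_cast this
        · have : m ≤ r + 1 := by omega
          exact_mod_cast this
      have h2 : M m ≤ ∑ m ∈ Finset.Icc (-r - 1 : ℤ) r, M m :=
        Finset.single_le_sum (fun i _ => hM i) hm
      have h3 := (hMd m k t ht).trans h2
      have h4 : 1 + |(m : ℝ)| ≤ r + 2 := by linarith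
      exact mul_le_mul h3 (pow_le_pow_left₀ (by positivity) h4 3) (by positivity)
        ((abs_nonneg _).trans h3)
    · have : lagrangePiece r m = 0 := by
        refine if_neg fun h => hm ?_
        rw [unitStencil, Finset.mem_Icc] at h
        rw [Finset.mem_Icc]
        omega
      rw [this]
      simp only [zero_comp, iterate_derivative_zero, eval_zero, abs_zero, zero_mul]
      exact mul_nonneg (Finset.sum_nonneg fun m _ => hM m) (by positivity)

/-! ### A common generating function and a uniform stability constant. -/

/-- Every cardinal basis consists of the scaled translates of one function. -/
theorem IsCardinalBasis.exists_eq {r : ℕ} {Δx : ℝ} (hΔx : 0 < Δx) {ψ : ℤ → ℝ → ℝ}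
    (h : IsCardinalBasis r Δx ψ) : ∃ F : ℝ → ℝ,
      (F = lagrangeCardinal r 1 0 ∨ IsCardinalSpline r 1 0 F) ∧
        ∀ j x, ψ j x = F (x / Δx - j) := by
  rcases h with rfl | h
  · exact ⟨_, Or.inl rfl, fun j x => lagrangeCardinal_eq hΔx j x⟩
  · refine ⟨_, Or.inr ((h 0).rescale hΔx), fun j x => ?_⟩
    -- Each `ψ j` is given as some spline; uniqueness identifies it with the translate of `ψ 0`.
    obtain ⟨p, hp⟩ := ((h 0).rescale hΔx).exists_isPiecewiseCardinal
    obtain ⟨p', hp'⟩ := ((h j).rescale hΔx).exists_isPiecewiseCardinal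
    have hx := congrFun (hp.eq_of_isPiecewiseCardinal
      (fun s => by split_ifs <;> norm_num) (by simp) hp') (x / Δx - j)
    rw [hx, sub_add_cancel, div_mul_cancel₀ _ hΔx.ne']

theorem exists_isPiecewiseCardinal {r : ℕ} {F : ℝ → ℝ}
    (h : F = lagrangeCardinal r 1 0 ∨ IsCardinalSpline r 1 0 F) :
    ∃ a p, IsPiecewiseCardinal r a p F := by
  rcases h with rfl | h
  · obtain ⟨a, -, -, p, hp⟩ := exists_isPiecewiseCardinal_lagrange r
    exact ⟨a, p, hp⟩
  · obtain ⟨p, hp⟩ := h.exists_isPiecewiseCardinal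
    exact ⟨_, p, hp⟩

/-- The constant has to precede the choice of `F`. Uniqueness of the spline makes one constant serve
all, and if there is no spline the claim about splines is vacuous. -/
theorem exists_stability_const (r : ℕ) : ∃ K : ℝ, 0 ≤ K ∧ ∀ F : ℝ → ℝ,
    (F = lagrangeCardinal r 1 0 ∨ IsCardinalSpline r 1 0 F) →
      ∀ ε : ℝ, 0 ≤ ε → ε ≤ 1 / 2 → ∀ α : ℤ → ℝ,
        (∀ i j : ℤ, |α i - α j - (i - j)| ≤ ε * |(i : ℝ) - j|) →
          ∀ (I J : Finset ℤ) (c : ℤ → ℝ),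
            ∑ i ∈ I, (∑ j ∈ J, F (α i - j) * c j) ^ 2 ≤ (1 + K * ε) * ∑ j ∈ J, c j ^ 2 := by
  obtain ⟨a, ha, har, p, hp⟩ := exists_isPiecewiseCardinal_lagrange r
  obtain ⟨K₁, hK₁, h₁⟩ := hp.exists_sum_sq_le ha har
  have hδ : ∀ s : ℕ, (0 : ℝ) ≤ if s = r then 1 else 0 := fun s => by split_ifs <;> norm_num
  obtain ⟨K₂, hK₂, h₂⟩ : ∃ K : ℝ, 0 ≤ K ∧ ∀ F : ℝ → ℝ, IsCardinalSpline r 1 0 F →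
      ∀ ε : ℝ, 0 ≤ ε → ε ≤ 1 / 2 → ∀ α : ℤ → ℝ,
        (∀ i j : ℤ, |α i - α j - (i - j)| ≤ ε * |(i : ℝ) - j|) →
          ∀ (I J : Finset ℤ) (c : ℤ → ℝ),
            ∑ i ∈ I, (∑ j ∈ J, F (α i - j) * c j) ^ 2 ≤ (1 + K * ε) * ∑ j ∈ J, c j ^ 2 := by
    by_cases hex : ∃ F, IsCardinalSpline r 1 0 F
    · obtain ⟨F₀, hF₀⟩ := hex
      obtain ⟨p, hp⟩ := hF₀.exists_isPiecewiseCardinal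
      obtain ⟨K, hK, h⟩ := hp.exists_sum_sq_le hδ (by simp)
      refine ⟨K, hK, fun F hF => ?_⟩
      obtain ⟨p', hp'⟩ := hF.exists_isPiecewiseCardinal
      rwa [← hp.eq_of_isPiecewiseCardinal hδ (by simp) hp']
    · exact ⟨0, le_rfl, fun F hF => absurd ⟨F, hF⟩ hex⟩
  refine ⟨K₁ + K₂, by positivity, fun F hF ε hε hε' α hα I J c => ?_⟩
  have hc : 0 ≤ ∑ j ∈ J, c j ^ 2 := Finset.sum_nonneg fun _ _ => sq_nonneg _
  rcases hF with rfl | hF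
  · exact (h₁ ε hε hε' α hα I J c).trans (by gcongr; linarith)
  · exact (h₂ F hF ε hε hε' α hα I J c).trans (by gcongr; linarith)

/-! ### Lipschitz estimate for the discrete characteristics. -/

theorem H2.exists_abs_sub_le {u : ℝ → ℝ} (hu : H2 u) :
    ∃ K : ℝ, 0 ≤ K ∧ ∀ x y, |u x - u y| ≤ K * |x - y| := by
  obtain ⟨hc, K, hK⟩ := hu
  refine ⟨K, (abs_nonneg _).trans (hK 0 (by norm_num) 0), fun x y => ?_⟩
  refine Convex.norm_image_sub_le_of_norm_deriv_le (s := univ) (f := u)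
    (fun w _ => (hc.differentiable (by norm_num)).differentiableAt) (fun w _ => ?_) convex_univ
    (mem_univ y) (mem_univ x)
  have := hK 1 (by norm_num) w
  rwa [iteratedDeriv_one] at this

/-- The diffusive shift cancels in the difference of the implicit equations at `x` and `y`. The
remaining defect `d` satisfies `|d| ≤ K Δt |x - y| + (K Δt / 2) |d|`, and the last term is absorbed
on the left. -/
theorem IsDiscreteCharacteristic.abs_sub_sub_le {u : ℝ → ℝ} {K : ℝ} (hK : 0 ≤ K)
    (hu : ∀ x y, |u x - u y| ≤ K * |x - y|) {ν Δt : ℝ} (hΔt : 0 < Δt) (hKΔt : K * Δt ≤ 1)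
    {k : SignType} {z : ℝ → ℝ} (hz : IsDiscreteCharacteristic u ν Δt k z) (x y : ℝ) :
    |z x - z y - (x - y)| ≤ 2 * K * Δt * |x - y| := by
  set d := z x - z y - (x - y) with hd
  have h1 : d = -(Δt / 2) * ((u x - u y) + (u (z x) - u (z y))) := by
    rw [hd]
    linear_combination hz x - hz y
  have h2 : |z x - z y| ≤ |d| + |x - y| := by
    rw [show z x - z y = d + (x - y) by rw [hd]; ring]
    exact abs_add_le _ _
  have h3 : |d| ≤ Δt / 2 * (K * |x - y| + K * (|d| + |x - y|)) := by
    conv_lhs => rw [h1]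
    rw [abs_mul, abs_neg, abs_of_pos (half_pos hΔt)]
    gcongr
    refine (abs_add_le _ _).trans (add_le_add (hu _ _) ((hu _ _).trans ?_))
    gcongr
  have h4 : K * Δt * |d| ≤ 1 * |d| := mul_le_mul_of_nonneg_right hKΔt (abs_nonneg _)
  linarith

/-! ### Linear interpolation on `ℓ^∞`. -/

theorem matrixNormLE_top_of_convex {B : Matrix ℤ ℤ ℝ} (m : ℤ → ℤ) (t : ℤ → ℝ)
    (ht : ∀ i, t i ∈ Icc (0 : ℝ) 1)
    (hB : ∀ i j, B i j = (1 - t i) * (if j = m i then 1 else 0) +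
      t i * (if j = m i + 1 then 1 else 0)) : MatrixNormLE ⊤ B 1 := by
  have hsum : ∀ (c : ℤ → ℝ) (i : ℤ),
      HasSum (fun j => B i j * c j) ((1 - t i) * c (m i) + t i * c (m i + 1)) := by
    intro c i
    refine ((hasSum_ite_eq (m i) ((1 - t i) * c (m i))).add
      (hasSum_ite_eq (m i + 1) (t i * c (m i + 1)))).congr_fun fun j => ?_
    rw [hB]
    by_cases h1 : j = m i <;> by_cases h2 : j = m i + 1 <;> simp [h1, h2]
  have hbound : ∀ (c : lp (fun _ : ℤ => ℝ) ⊤) (i : ℤ),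
      ‖(1 - t i) * c (m i) + t i * c (m i + 1)‖ ≤ ‖c‖ := by
    intro c i
    have h0 := (ht i).1
    have h1 : 0 ≤ 1 - t i := by linarith [(ht i).2]
    have hc := fun j => lp.norm_apply_le_norm ENNReal.top_ne_zero c j
    calc _ ≤ (1 - t i) * ‖c (m i)‖ + t i * ‖c (m i + 1)‖ := by
          refine (norm_add_le _ _).trans (le_of_eq ?_)
          rw [norm_mul, norm_mul, Real.norm_of_nonneg h0, Real.norm_of_nonneg h1]
      _ ≤ (1 - t i) * ‖c‖ + t i * ‖c‖ := by
          gcongr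
          · exact hc _
          · exact hc _
      _ = ‖c‖ := by ring
  let T : lp (fun _ : ℤ => ℝ) ⊤ →ₗ[ℝ] lp (fun _ : ℤ => ℝ) ⊤ :=
    { toFun := fun c => ⟨fun i => (1 - t i) * c (m i) + t i * c (m i + 1),
        memℓp_infty ⟨‖c‖, by rintro _ ⟨i, rfl⟩; exact hbound c i⟩⟩
      map_add' := fun c d => by
        ext i
        simp only [lp.coeFn_add, Pi.add_apply]
        ring
      map_smul' := fun s c => by
        ext i
        simp only [lp.coeFn_smul, Pi.smul_apply, smul_eq_mul, RingHom.id_apply]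
        ring }
  refine ⟨T.mkContinuous 1 fun c => ?_, fun c i => hsum c i,
    LinearMap.mkContinuous_norm_le _ zero_le_one _⟩
  rw [one_mul]
  exact lp.norm_le_of_forall_le (norm_nonneg _) (hbound c)

/-- A piece of degree at most one is fixed by its two end values, so for `r = 0` both bases give the
hat function. -/
theorem IsPiecewiseCardinal.eq_hat {a : ℕ → ℝ} {p : ℤ → ℝ[X]} {F : ℝ → ℝ}
    (h : IsPiecewiseCardinal 0 a p F) (m : ℤ) {t : ℝ} (ht : t ∈ Icc (0 : ℝ) 1) :
    F (m + t) = (1 - t) * (if m = 0 then 1 else 0) + t * (if m + 1 = 0 then 1 else 0) := by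
  have h0 := h.eq_eval m 0 (by simp)
  have h1 := h.eq_eval m 1 (by simp)
  have hm := h.cardinal (m + 1)
  push_cast at hm
  rw [add_zero, h.cardinal] at h0
  rw [hm] at h1
  rw [h.eq_eval m t ht, h0, h1, eq_X_add_C_of_natDegree_le_one (h.natDegree_le m)]
  simp only [eval_add, eval_mul, eval_C, eval_X]
  ring

end SemiLagrangian

/-! ### The two stability bounds. -/

theorem mainTheorem3 (u : ℝ → ℝ) (hu : SemiLagrangian.H2 u) (ν : ℝ) (hν : 0 ≤ ν)
    (k : SignType) :
    (∀ r : ℕ, ∃ K_B : ℝ, 0 < K_B ∧ ∃ Δt₀ : ℝ, 0 < Δt₀ ∧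
      ∀ Δt : ℝ, 0 < Δt → Δt ≤ Δt₀ → ∀ Δx : ℝ, 0 < Δx →
        ∀ z : ℝ → ℝ, SemiLagrangian.IsDiscreteCharacteristic u ν Δt k z →
          ∀ ψ : ℤ → ℝ → ℝ, SemiLagrangian.IsCardinalBasis r Δx ψ →
            SemiLagrangian.MatrixNormLE 2 (SemiLagrangian.interpMatrix Δx ψ z)
              (1 + K_B * Δt)) ∧
    (∀ Δt : ℝ, 0 < Δt → ∀ Δx : ℝ, 0 < Δx →
      ∀ z : ℝ → ℝ, SemiLagrangian.IsDiscreteCharacteristic u ν Δt k z →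
        ∀ ψ : ℤ → ℝ → ℝ, SemiLagrangian.IsCardinalBasis 0 Δx ψ →
          SemiLagrangian.MatrixNormLE ⊤ (SemiLagrangian.interpMatrix Δx ψ z) 1) := by
  constructor
  · intro r
    obtain ⟨L, hL, hLu⟩ := hu.exists_abs_sub_le
    obtain ⟨K, hK, hstab⟩ := SemiLagrangian.exists_stability_const r
    -- With `ε = 2 L Δt`, the choice of `Δt₀` ensures `ε ≤ 1 / 2` and `L Δt ≤ 1`. The summands `+ 1`
    -- keep `K_B` positive and the denominator nonzero when `L = 0`.
    refine ⟨K * (2 * L) + 1, by positivity, 1 / (4 * (L + 1)), by positivity,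
      fun Δt hΔt hΔt₀ Δx hΔx z hz ψ hψ => ?_⟩
    obtain ⟨F, hF, hψF⟩ := hψ.exists_eq hΔx
    rw [le_div_iff₀ (by positivity)] at hΔt₀
    have hLΔt : 4 * (L * Δt) ≤ 1 := by linarith
    refine SemiLagrangian.matrixNormLE_two (by positivity) fun I J c => ?_
    have h1 := hstab F hF (2 * L * Δt) (by positivity) (by linarith)
      (fun i => z ((i : ℝ) * Δx) / Δx) (fun i j => ?_) I J c
    · have hc : 0 ≤ ∑ j ∈ J, c j ^ 2 := Finset.sum_nonneg fun _ _ => sq_nonneg _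
      simp only [SemiLagrangian.interpMatrix, Matrix.of_apply, hψF]
      -- It remains that `1 + 2 K L Δt ≤ (1 + K_B Δt)²`, which holds with room to spare.
      refine h1.trans (mul_le_mul_of_nonneg_right ?_ hc)
      have h2 : 0 ≤ K * (2 * L) * Δt := by positivity
      nlinarith
    · have h3 := hz.abs_sub_sub_le hL hLu hΔt (by linarith) ((i : ℝ) * Δx) ((j : ℝ) * Δx)
      have h4 : z ((i : ℝ) * Δx) / Δx - z ((j : ℝ) * Δx) / Δx - (i - j) =
          (z ((i : ℝ) * Δx) - z ((j : ℝ) * Δx) - ((i : ℝ) * Δx - (j : ℝ) * Δx)) / Δx := by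
        field_simp
      rw [h4, abs_div, abs_of_pos hΔx, div_le_iff₀ hΔx]
      rw [← sub_mul (i : ℝ) (j : ℝ) Δx, abs_mul ((i : ℝ) - j), abs_of_pos hΔx, ← mul_assoc] at h3
      rwa [sub_mul] at h3
  · intro Δt _ Δx hΔx z _ ψ hψ
    obtain ⟨F, hF, hψF⟩ := hψ.exists_eq hΔx
    obtain ⟨a, p, hp⟩ := SemiLagrangian.exists_isPiecewiseCardinal hF
    refine SemiLagrangian.matrixNormLE_top_of_convex (fun i => ⌊z ((i : ℝ) * Δx) / Δx⌋)
      (fun i => Int.fract (z ((i : ℝ) * Δx) / Δx))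
      (fun i => ⟨Int.fract_nonneg _, (Int.fract_lt_one _).le⟩) fun i j => ?_
    simp only [SemiLagrangian.interpMatrix, Matrix.of_apply, hψF]
    set y := z ((i : ℝ) * Δx) / Δx
    have h1 := hp.eq_hat (⌊y⌋ - j) (t := Int.fract y)
      ⟨Int.fract_nonneg _, (Int.fract_lt_one _).le⟩
    have h2 : y - j = ((⌊y⌋ - j : ℤ) : ℝ) + Int.fract y := by
      push_cast
      linarith [Int.floor_add_fract y]
    rw [h2, h1]
    congr 3
    · exact propext ⟨fun h => by omega, fun h => by omega⟩
    · exact propext ⟨fun h => by omega, fun h => by omega⟩
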